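/- Let $N\ge 3$ and let $L_1,\dots,L_{N-1}$ be ARQ window sizes. Consider an $N$-node half-duplex multihop network (node $1$ the source, node $N$ the destination, hop $i$ from node $i$ to node $i+1$) under the following queueing model. Messages $n=0,1,2,\dots$ arrive at the source as a Poisson process with mean inter-arrival time $\lambda$; write $A_n^1$ for the time between the arrivals of messages $n-1$ and $n$. The service time $S_n^i$ of message $n$ on hop $i$ is exponential with mean $\mu(L_i)>0$ (a quantity that may also depend on the hop), $1\le i\le N-1$. Because a node must wait until the previous message has been transmitted over the two following hops, there are $N-2$ first-come-first-served queues in tandem, queue $i$ being occupied by a message during its transmission over the hops $i$ and $i+1$; this occupation time is modeled (in place of $S_n^i+S_n^{i+1}$) by an exponential variable $T_n^i$ with mean $\mu(L_i)+\mu(L_{i+1})$, $1\le i\le N-2$. For each message the variables $S_n^1,\dots,S_n^{N-1}$ are independent, and so are $T_n^1,\dots,T_n^{N-2}$ (the dependence between the two families is arbitrary); the vectors of service times of the messages are i.i.d. and independent of the arrivals. The waiting times $W_n^i$ are given by $W_0^i=0$ and, for $n\ge1$, \[ W_n^i=\max\bigl(W_{n-1}^i+T_{n-1}^i-A_n^i,\,0\bigr),\qquad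 D_n^i=W_n^i+T_n^i,\qquad 1\le i\le N-2, \] \[ A_n^{i}=A_n^{i-1}+D_n^{i-1}-D_{n-1}^{i-1},\qquad 2\le i\le N-2 , \] and the end-to-end delay of message $n$ is \[ D_n=\sum_{i=1}^{N-2}W_n^i+\sum_{i=1}^{N-1}S_n^i . \] Let $t_n^i$ be the number of ARQ rounds that message $n$ needs on hop $i$. The event $\bigcap_{i=1}^{N-1}\{t_n^i\le L_i\}$ that message $n$ is not in outage is assumed to have positive probability for every $n$, and the model above is assumed to hold conditionally on that event, for every $n$, with the same law of the service-time vectors. Assume the stability condition $\mu(L_i)+\mu(L_{i+1})<\lambda$ for $1\le i\le N-2$. Then for every deadline $k$ the limit \[ P_{\mathrm{deadline}}(k)=\lim_{n\to\infty}P\Bigl\{D_n>k\,\Bigm|\,\bigcap_{i=1}^{N-1}\{t_n^i\le L_i\}\Bigr\} \] exists and is positive, and the deadline-missing probability has exponential decay rate \[ \lim_{k\to\infty}\lim_{n\to\infty}\frac1k\log P\Bigl\{D_n>k\,\Bigm|\,\bigcap_{i=1}^{N-1}\{t_n^i\le L_i\}\Bigr\}=-\theta^*,\qquad \theta^*=\min_{1\le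 i\le N-2}\Bigl(\frac1{\mu(L_i)+\mu(L_{i+1})}-\frac1\lambda\Bigr). \] -/

import Mathlib

open MeasureTheory ProbabilityTheory Filter Topology

namespace HalfDuplex

/-- Waiting times in a first-come-first-served single-server queue that is empty when message `0`
arrives: Lindley's recursion `W (n+1) = (W n + s n - a (n+1))⁺`, where `s n` is the service time of
message `n` and `a (n+1)` the time between the arrivals of the messages `n` and `n+1`. -/
def waiting (a s : ℕ → ℝ) : ℕ → ℝ
  | 0 => 0
  | n + 1 => max (waiting a s n + s n - a (n + 1)) 0

/-- Time spent by message `n` in the queue: waiting time plus service time. -/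
def sojourn (a s : ℕ → ℝ) (n : ℕ) : ℝ := waiting a s n + s n

/-- Time between the departures of the messages `n-1` and `n`, for `n ≥ 1`
(the value at `n = 0` is never used). -/
def departureGap (a s : ℕ → ℝ) (n : ℕ) : ℝ := a n + sojourn a s n - sojourn a s (n - 1)

/-- `interarrival A T i` is the sequence of inter-arrival times at queue `i = 1, 2, …`: queue `1`
(the source) sees the external inter-arrival times `A`, and the arrivals at queue `i + 1` are the
departures from queue `i`. Here `T n i` is the time for which message `n` occupies queue `i`
(index `i = 0` is never used). -/
def interarrival (A : ℕ → ℝ) (T : ℕ → ℕ → ℝ) : ℕ → ℕ → ℝ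
  | 0 => A
  | 1 => A
  | i + 2 => departureGap (interarrival A T (i + 1)) (fun n => T n (i + 1))

/-- Waiting time `W_n^i` of message `n` at queue `i`. -/
def queueWaiting (A : ℕ → ℝ) (T : ℕ → ℕ → ℝ) (n i : ℕ) : ℝ :=
  waiting (interarrival A T i) (fun m => T m i) n

/-- End-to-end delay `D_n = W_n + S_n` of message `n` in an `N`-node half-duplex network: the total
queueing delay `W_n` over the `N - 2` queues plus the total service time `S_n` over the `N - 1`
hops. -/
def endToEndDelay (N : ℕ) (A : ℕ → ℝ) (S T : ℕ → ℕ → ℝ) (n : ℕ) : ℝ :=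
  ∑ i ∈ Finset.Icc 1 (N - 2), queueWaiting A T n i + ∑ i ∈ Finset.Icc 1 (N - 1), S n i

/-- The times attached to one message: its service times on the `N - 1` hops, and its service times
at the `N - 2` queues. Queue `i` is busy with a message during the two consecutive transmissions
over the hops `i` and `i + 1`, because of half-duplexing. -/
abbrev MessageTimes (N : ℕ) : Type :=
  (Finset.Icc 1 (N - 1) → ℝ) × (Finset.Icc 1 (N - 2) → ℝ)

/-- The law `ν` of the service times of one message: with `m i` the mean service time of hop `i`,
the service time of hop `i` is exponential with mean `m i`, independently over the hops, and the
service time at queue `i` (hops `i` and `i + 1` together) is exponential with mean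
`m i + m (i + 1)`, independently over the queues. No assumption is made on the dependence between
the hop service times and the queue service times of the message. -/
structure IsMessageLaw (N : ℕ) (m : ℕ → ℝ) (ν : Measure (MessageTimes N)) : Prop where
  hop_law : ∀ i : Finset.Icc 1 (N - 1), HasLaw (fun x => x.1 i) (expMeasure (1 / m i)) ν
  hop_indep : iIndepFun (fun (i : Finset.Icc 1 (N - 1)) (x : MessageTimes N) => x.1 i) ν
  queue_law : ∀ i : Finset.Icc 1 (N - 2),
    HasLaw (fun x => x.2 i) (expMeasure (1 / (m i + m (i + 1)))) ν
  queue_indep : iIndepFun (fun (i : Finset.Icc 1 (N - 2)) (x : MessageTimes N) => x.2 i) ν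

/-- The service times of message `n` as a random element. -/
def messageTimes {Ω : Type*} (N : ℕ) (S T : ℕ → ℕ → Ω → ℝ) (n : ℕ) (ω : Ω) : MessageTimes N :=
  (fun i => S n i ω, fun i => T n i ω)

/-- Under `Q`, the external arrivals form a Poisson process with mean inter-arrival time `lam`,
the service times of the messages are i.i.d. with law `ν`, and arrivals and services are
independent. -/
structure IsQueueingModel {Ω : Type*} [MeasurableSpace Ω] (N : ℕ) (lam : ℝ)
    (ν : Measure (MessageTimes N)) (A : ℕ → Ω → ℝ) (S T : ℕ → ℕ → Ω → ℝ) (Q : Measure Ω) :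
    Prop where
  arrival_law : ∀ n, HasLaw (A n) (expMeasure (1 / lam)) Q
  arrival_indep : iIndepFun A Q
  message_law : ∀ n, HasLaw (messageTimes N S T n) ν Q
  message_indep : iIndepFun (messageTimes N S T) Q
  arrival_message_indep :
    IndepFun (fun ω n => A n ω) (fun ω n => messageTimes N S T n ω) Q

/-- The event that message `n` suffers no information outage: on every hop `i` the number
`t n i` of transmission rounds it needs is within the ARQ window `L i`. -/
def noOutage {Ω : Type*} (N : ℕ) (t : ℕ → ℕ → Ω → ℝ) (L : ℕ → ℕ) (n : ℕ) : Set Ω :=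
  {ω | ∀ i ∈ Finset.Icc 1 (N - 1), t n i ω ≤ L i}

/-- The probability that the delay of message `n` exceeds `k`, given no information outage of
message `n`. -/
noncomputable def missProb {Ω : Type*} [MeasurableSpace Ω] (N : ℕ) (P : Measure Ω)
    (t : ℕ → ℕ → Ω → ℝ) (L : ℕ → ℕ) (A : ℕ → Ω → ℝ) (S T : ℕ → ℕ → Ω → ℝ) (n : ℕ) (k : ℝ) : ℝ :=
  (cond P (noOutage N t L n)).real
    {ω | k < endToEndDelay N (fun l => A l ω) (fun l i => S l i ω) (fun l i => T l i ω) n}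

end HalfDuplex

namespace HalfDuplex

/-! ### Pathwise properties of the tandem -/

/-! Measured from its arrival at the source, message `n + 1` starts service at queue `i + 1` once
its predecessor has left that queue and it has itself left queue `i`. Hence the total sojourn G
satisfies the last-passage recursion G(n+1, i+1) = T(n+1, i+1) + max (G(n, i+1) - A(n+1), G(n+1, i))
(`totalSojourn_succ_succ`), the source of all the bounds. Write M for the mean service time of a
queue.

Limit: the delay is a function of arrival and service times whose joint law is the same under every
conditional measure (`measure_lt_delay`). Deleting message `0` lowers delays but preserves the
model, so the probabilities increase with the message index and converge to their supremum.

Upper bound: with φ = E exp(θT) and ψ = E exp(-θA), independence gives E exp(θG(n+1, i+1)) ≤ φ (ψ E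
exp(θG(n, i+1)) + E exp(θG(n+1, i))). For θ > 0 below 1/M - 1/lam one has φψ < 1, so the moments
stay bounded in n, queue after queue (`exists_expMoment_totalSojourn_le`), and Chernoff's bound
applies. The hop times do not spoil the rate: each hop belongs to a queue with a larger mean.

Lower bound: at a bottleneck queue, G dominates a random walk with steps T - A. At θ = 1/M - 1/lam
the step has exponential moment 1, and its mean under the tilted law is lam - M. So in about k /
(lam - M) steps the walk exceeds k with probability exp(-θk), up to an arbitrarily small loss in the
exponent (`eventually_le_measure_walk`). -/

lemma waiting_nonneg (a s : ℕ → ℝ) (n : ℕ) : 0 ≤ waiting a s n := by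
  cases n with
  | zero => exact le_rfl
  | succ n => exact le_max_right _ _

lemma queueWaiting_nonneg (A : ℕ → ℝ) (T : ℕ → ℕ → ℝ) (n i : ℕ) : 0 ≤ queueWaiting A T n i :=
  waiting_nonneg _ _ _

/-- The total waiting time of message `n` in the first `i` queues. -/
def totalWaiting (A : ℕ → ℝ) (T : ℕ → ℕ → ℝ) (n i : ℕ) : ℝ :=
  ∑ j ∈ Finset.Icc 1 i, queueWaiting A T n j

/-- The total time spent by message `n` in the first `i` queues. -/
def totalSojourn (A : ℕ → ℝ) (T : ℕ → ℕ → ℝ) (n i : ℕ) : ℝ :=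
  totalWaiting A T n i + ∑ j ∈ Finset.Icc 1 i, T n j

section Pathwise

variable (A : ℕ → ℝ) (T : ℕ → ℕ → ℝ)

@[simp] lemma totalWaiting_zero_right (n : ℕ) : totalWaiting A T n 0 = 0 := by simp [totalWaiting]

@[simp] lemma totalSojourn_zero_right (n : ℕ) : totalSojourn A T n 0 = 0 := by simp [totalSojourn]

@[simp] lemma totalWaiting_zero_left (i : ℕ) : totalWaiting A T 0 i = 0 := by
  simp [totalWaiting, queueWaiting, waiting]

lemma totalWaiting_nonneg (n i : ℕ) : 0 ≤ totalWaiting A T n i :=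
  Finset.sum_nonneg fun _ _ => queueWaiting_nonneg A T _ _

lemma totalWaiting_succ_right (n i : ℕ) :
    totalWaiting A T n (i + 1) = totalWaiting A T n i + queueWaiting A T n (i + 1) :=
  Finset.sum_Icc_succ_top (by omega) _

lemma totalSojourn_succ_right (n i : ℕ) :
    totalSojourn A T n (i + 1)
      = totalSojourn A T n i + (queueWaiting A T n (i + 1) + T n (i + 1)) := by
  rw [totalSojourn, totalSojourn, totalWaiting_succ_right, Finset.sum_Icc_succ_top (by omega)]
  ring

/-- The departure gaps telescope: a message reaches queue `i + 1` at its source arrival time plus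
its sojourn in the first `i` queues. -/
lemma interarrival_succ (n i : ℕ) :
    interarrival A T (i + 1) (n + 1)
      = A (n + 1) + totalSojourn A T (n + 1) i - totalSojourn A T n i := by
  induction i with
  | zero => simp [interarrival]
  | succ i ih =>
    rw [interarrival, departureGap, ih, totalSojourn_succ_right, totalSojourn_succ_right]
    simp only [sojourn, queueWaiting, Nat.add_sub_cancel]
    ring

lemma queueWaiting_succ (n i : ℕ) :
    queueWaiting A T (n + 1) (i + 1)
      = max (totalSojourn A T n (i + 1) - A (n + 1) - totalSojourn A T (n + 1) i) 0 := by
  rw [queueWaiting, waiting, interarrival_succ, totalSojourn_succ_right]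
  simp only [queueWaiting]
  congr 1
  ring

/-- The last-passage recursion: service starts when both the queue and the message are available. It
is monotone in all sojourn times, which Lindley's recursion with random arrivals does not show. -/
lemma totalSojourn_succ_succ (n i : ℕ) :
    totalSojourn A T (n + 1) (i + 1)
      = T (n + 1) (i + 1)
        + max (totalSojourn A T n (i + 1) - A (n + 1)) (totalSojourn A T (n + 1) i) := by
  rw [totalSojourn_succ_right A T (n + 1), queueWaiting_succ]
  rcases le_total (totalSojourn A T n (i + 1) - A (n + 1)) (totalSojourn A T (n + 1) i) with h | h
  · rw [max_eq_right h, max_eq_right (by linarith)]; ring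
  · rw [max_eq_left h, max_eq_left (by linarith)]; ring

/-- The same recursion with the message's own queue service times removed, since the delay adds hop
times, not queue times, to the waiting. -/
lemma totalWaiting_succ_succ (n i : ℕ) :
    totalWaiting A T (n + 1) (i + 1)
      = max (totalSojourn A T n (i + 1) - A (n + 1) - ∑ j ∈ Finset.Icc 1 i, T (n + 1) j)
          (totalWaiting A T (n + 1) i) := by
  rw [totalWaiting_succ_right, queueWaiting_succ]
  have h : totalSojourn A T (n + 1) i
    = totalWaiting A T (n + 1) i + ∑ j ∈ Finset.Icc 1 i, T (n + 1) j := rfl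
  rw [h, ← max_add_add_left, add_zero]
  congr 1
  ring

lemma totalSojourn_zero_left (i : ℕ) : totalSojourn A T 0 i = ∑ j ∈ Finset.Icc 1 i, T 0 j := by
  simp [totalSojourn]

/-- Dropping message `0` can only decrease the sojourn times. -/
lemma totalSojourn_shift_le (n i : ℕ) :
    totalSojourn (fun n => A (n + 1)) (fun n => T (n + 1)) n i ≤ totalSojourn A T (n + 1) i := by
  induction n generalizing i with
  | zero =>
    rw [totalSojourn_zero_left, totalSojourn]
    linarith [totalWaiting_nonneg A T (0 + 1) i]
  | succ n ihn =>
    induction i with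
    | zero => simp
    | succ i ih =>
      rw [totalSojourn_succ_succ, totalSojourn_succ_succ]
      gcongr
      exact ihn _

/-- Dropping message `0` can only decrease the waiting times. -/
lemma totalWaiting_shift_le (n i : ℕ) :
    totalWaiting (fun n => A (n + 1)) (fun n => T (n + 1)) n i ≤ totalWaiting A T (n + 1) i := by
  cases n with
  | zero => rw [totalWaiting_zero_left]; exact totalWaiting_nonneg _ _ _ _
  | succ n =>
    induction i with
    | zero => simp
    | succ i ih =>
      rw [totalWaiting_succ_succ, totalWaiting_succ_succ]
      gcongr
      exact totalSojourn_shift_le A T n (i + 1)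

variable {A T}

/-- The total waiting time of a message is at most the total sojourn time of its predecessor. -/
lemma totalWaiting_succ_le (hA : ∀ n, 0 ≤ A n) {i : ℕ} (hT : ∀ n, ∀ j ∈ Finset.Icc 1 i, 0 ≤ T n j)
    (n : ℕ) : totalWaiting A T (n + 1) i ≤ totalSojourn A T n i := by
  induction i with
  | zero => simp
  | succ i ih =>
    have hT' : ∀ n, ∀ j ∈ Finset.Icc 1 i, 0 ≤ T n j := fun n j hj =>
      hT n j (Finset.Icc_subset_Icc_right (Nat.le_succ i) hj)
    rw [totalWaiting_succ_succ]
    refine max_le ?_ ((ih hT').trans ?_)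
    · linarith [hA (n + 1), Finset.sum_nonneg (hT' (n + 1))]
    · rw [totalSojourn_succ_right]
      linarith [queueWaiting_nonneg A T n (i + 1), hT n (i + 1) (by simp)]

/-- A message waits at least until its predecessor has left a given queue. -/
lemma le_totalWaiting_succ {i j : ℕ} (hT : ∀ n, ∀ l ∈ Finset.Icc 1 i, 0 ≤ T n l) (n : ℕ)
    (hj : j ∈ Finset.Icc 1 i) :
    totalSojourn A T n j - A (n + 1) - ∑ l ∈ Finset.Icc 1 i, T (n + 1) l
      ≤ totalWaiting A T (n + 1) i := by
  rw [Finset.mem_Icc] at hj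
  obtain ⟨j, rfl⟩ : ∃ j', j = j' + 1 := ⟨j - 1, by omega⟩
  calc _ ≤ totalSojourn A T n (j + 1) - A (n + 1) - ∑ l ∈ Finset.Icc 1 j, T (n + 1) l := by
        have : ∑ l ∈ Finset.Icc 1 j, T (n + 1) l ≤ ∑ l ∈ Finset.Icc 1 i, T (n + 1) l :=
          Finset.sum_le_sum_of_subset_of_nonneg (Finset.Icc_subset_Icc_right (by omega))
            fun l hl _ => hT _ l hl
        linarith
    _ ≤ totalWaiting A T (n + 1) (j + 1) := by
        rw [totalWaiting_succ_succ]; exact le_max_left _ _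
    _ ≤ _ := Finset.sum_le_sum_of_subset_of_nonneg (Finset.Icc_subset_Icc_right (by omega))
        fun l _ _ => queueWaiting_nonneg A T _ l

/-- Keeping only the predecessor's branch of the maximum at each step leaves a random walk. -/
lemma sum_range_le_totalSojourn {j : ℕ} (hT : ∀ n, ∀ l ∈ Finset.Icc 1 j, 0 ≤ T n l) (hj : 1 ≤ j)
    (n : ℕ) : ∑ m ∈ Finset.range n, (T (m + 1) j - A (m + 1)) ≤ totalSojourn A T n j := by
  obtain ⟨j, rfl⟩ : ∃ j', j = j' + 1 := ⟨j - 1, by omega⟩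
  induction n with
  | zero => simpa [totalSojourn_zero_left] using Finset.sum_nonneg (hT 0)
  | succ n ih =>
    rw [Finset.sum_range_succ, totalSojourn_succ_succ]
    linarith [le_max_left (totalSojourn A T n (j + 1) - A (n + 1)) (totalSojourn A T (n + 1) j)]

lemma interarrival_congr {T' : ℕ → ℕ → ℝ} (i : ℕ)
    (h : ∀ n j, 1 ≤ j → j < i → T n j = T' n j) : interarrival A T i = interarrival A T' i := by
  induction i with
  | zero => rfl
  | succ i ih =>
    cases i with
    | zero => rfl
    | succ i =>
      rw [interarrival, interarrival, ih fun n j hj hi => h n j hj (by omega),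
        funext fun n => h n (i + 1) (by omega) (by omega)]

lemma totalWaiting_congr {T' : ℕ → ℕ → ℝ} {i : ℕ} (h : ∀ n, ∀ j ∈ Finset.Icc 1 i, T n j = T' n j)
    (n : ℕ) : totalWaiting A T n i = totalWaiting A T' n i := by
  refine Finset.sum_congr rfl fun j hj => ?_
  rw [queueWaiting, queueWaiting, funext fun n => h n j hj]
  rw [Finset.mem_Icc] at hj
  rw [interarrival_congr (T' := T') j fun n l hl hlj => h n l (Finset.mem_Icc.2 ⟨hl, by omega⟩)]

end Pathwise

/-- The σ-algebra is arbitrary and only the variables actually used must be measurable, so that this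
applies to `past` and `beforeService`. -/
lemma measurable_totalSojourn {Ω : Type*} {mΩ : MeasurableSpace Ω} {A : ℕ → Ω → ℝ}
    {T : ℕ → ℕ → Ω → ℝ} {n i : ℕ} (hA : ∀ m ≤ n, Measurable (A m))
    (hT : ∀ m ≤ n, ∀ j ∈ Finset.Icc 1 i, Measurable (T m j)) :
    Measurable fun ω => totalSojourn (fun m => A m ω) (fun m j => T m j ω) n i := by
  induction n generalizing i with
  | zero =>
    simp only [totalSojourn_zero_left]
    exact Finset.measurable_sum _ (hT 0 le_rfl)
  | succ n ihn =>
    induction i with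
    | zero => simp
    | succ i ih =>
      simp only [totalSojourn_succ_succ]
      refine (hT _ le_rfl (i + 1) (by simp)).add (Measurable.max (.sub ?_ (hA _ le_rfl)) ?_)
      · exact ihn (fun m hm => hA m (by omega)) fun m hm => hT m (by omega)
      · exact ih fun m hm j hj => hT m hm j (Finset.Icc_subset_Icc_right (Nat.le_succ i) hj)

lemma measurable_totalWaiting {Ω : Type*} {mΩ : MeasurableSpace Ω} {A : ℕ → Ω → ℝ}
    {T : ℕ → ℕ → Ω → ℝ} {n i : ℕ} (hA : ∀ m ≤ n, Measurable (A m))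
    (hT : ∀ m ≤ n, ∀ j ∈ Finset.Icc 1 i, Measurable (T m j)) :
    Measurable fun ω => totalWaiting (fun m => A m ω) (fun m j => T m j ω) n i := by
  have h : (fun ω => totalWaiting (fun m => A m ω) (fun m j => T m j ω) n i)
      = fun ω => totalSojourn (fun m => A m ω) (fun m j => T m j ω) n i
        - ∑ j ∈ Finset.Icc 1 i, T n j ω := by
    funext ω
    simp [totalSojourn]
  rw [h]
  exact (measurable_totalSojourn hA hT).sub (Finset.measurable_sum _ (hT n le_rfl))

/-! ### Independence -/

section Indep

variable {Ω : Type*} {mΩ : MeasurableSpace Ω} {Q : Measure Ω}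

/-- If `a, b` are independent, `c, d` are independent, and `a ⊔ b` and `c ⊔ d` are independent, then
`a ⊔ c` and `b ⊔ d` are independent. -/
lemma indep_sup_sup [IsProbabilityMeasure Q] {a b c d : MeasurableSpace Ω} (ha : a ≤ mΩ)
    (hb : b ≤ mΩ) (hc : c ≤ mΩ) (hd : d ≤ mΩ) (hab : Indep a b Q) (hcd : Indep c d Q)
    (h : Indep (a ⊔ b) (c ⊔ d) Q) : Indep (a ⊔ c) (b ⊔ d) Q := by
  have key (m₁ m₂ : MeasurableSpace Ω) : m₁ ⊔ m₂ = MeasurableSpace.generateFrom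
      (Set.image2 (· ∩ ·) {s | MeasurableSet[m₁] s} {s | MeasurableSet[m₂] s}) := by
    refine le_antisymm (sup_le (fun s hs => ?_) fun s hs => ?_) ?_
    · exact MeasurableSpace.measurableSet_generateFrom
        ⟨s, hs, Set.univ, MeasurableSet.univ, Set.inter_univ s⟩
    · exact MeasurableSpace.measurableSet_generateFrom
        ⟨Set.univ, MeasurableSet.univ, s, hs, Set.univ_inter s⟩
    · refine MeasurableSpace.generateFrom_le ?_
      rintro _ ⟨s, hs, t, ht, rfl⟩
      exact MeasurableSet.inter (le_sup_left (a := m₁) _ hs) (le_sup_right (b := m₂) _ ht)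
  have hpi (m₁ m₂ : MeasurableSpace Ω) : IsPiSystem
      (Set.image2 (· ∩ ·) {s | MeasurableSet[m₁] s} {s | MeasurableSet[m₂] s}) := by
    rintro _ ⟨s, hs, t, ht, rfl⟩ _ ⟨u, hu, v, hv, rfl⟩ _
    exact ⟨s ∩ u, MeasurableSet.inter hs hu, t ∩ v, MeasurableSet.inter ht hv,
      Set.inter_inter_inter_comm _ _ _ _⟩
  refine IndepSets.indep (sup_le ha hc) (sup_le hb hd) (hpi a c) (hpi b d) (key a c) (key b d) ?_
  · rw [IndepSets_iff]
    rintro _ _ ⟨s, hs, t, ht, rfl⟩ ⟨u, hu, v, hv, rfl⟩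
    rw [Indep_iff] at hab hcd h
    have hs' : MeasurableSet[a ⊔ b] s := le_sup_left (a := a) _ hs
    have hu' : MeasurableSet[a ⊔ b] u := le_sup_right (b := b) _ hu
    have ht' : MeasurableSet[c ⊔ d] t := le_sup_left (a := c) _ ht
    have hv' : MeasurableSet[c ⊔ d] v := le_sup_right (b := d) _ hv
    rw [Set.inter_inter_inter_comm, h _ _ (hs'.inter hu') (ht'.inter hv'), hab _ _ hs hu,
      hcd _ _ ht hv, h _ _ hs' ht', h _ _ hu' hv', mul_mul_mul_comm]

lemma indep_sup_right [IsProbabilityMeasure Q] {a b d : MeasurableSpace Ω} (ha : a ≤ mΩ)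
    (hb : b ≤ mΩ) (hd : d ≤ mΩ) (hab : Indep a b Q) (h : Indep (a ⊔ b) d Q) :
    Indep a (b ⊔ d) Q := by
  have := indep_sup_sup ha hb bot_le hd hab (indep_bot_left d) (by rwa [bot_sup_eq])
  rwa [sup_bot_eq] at this

lemma indep_comap_iSup_comap {ι : Type*} {β : ι → Type*} [∀ i, MeasurableSpace (β i)]
    {X : ∀ i, Ω → β i} (hX : iIndepFun X Q) (hm : ∀ i, Measurable (X i)) {i : ι} {s : Set ι}
    (hi : i ∉ s) :
    Indep (MeasurableSpace.comap (X i) inferInstance)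
      (⨆ j ∈ s, MeasurableSpace.comap (X j) inferInstance) Q := by
  have := indep_iSup_of_disjoint (fun j => (hm j).comap_le) hX.iIndep
    (Set.disjoint_singleton_left.2 hi)
  simpa using this

end Indep

/-! ### σ-algebras of past and present messages -/

section Information

variable {Ω : Type*} {N : ℕ} {A : ℕ → Ω → ℝ} {S T : ℕ → ℕ → Ω → ℝ}

/-- The information carried by the messages before message `n`. -/
abbrev past (N : ℕ) (A : ℕ → Ω → ℝ) (S T : ℕ → ℕ → Ω → ℝ) (n : ℕ) : MeasurableSpace Ω :=
  (⨆ m ∈ Set.Iio n, MeasurableSpace.comap (A m) inferInstance) ⊔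
    ⨆ m ∈ Set.Iio n, MeasurableSpace.comap (messageTimes N S T m) inferInstance

/-- The information carried by message `n`. -/
abbrev present (N : ℕ) (A : ℕ → Ω → ℝ) (S T : ℕ → ℕ → Ω → ℝ) (n : ℕ) : MeasurableSpace Ω :=
  MeasurableSpace.comap (A n) inferInstance ⊔
    MeasurableSpace.comap (messageTimes N S T n) inferInstance

lemma measurable_past_arrival {m n : ℕ} (hmn : m < n) : Measurable[past N A S T n] (A m) :=
  Measurable.mono (comap_measurable _)
    ((le_biSup (fun m => MeasurableSpace.comap (A m) inferInstance)
      (show m ∈ Set.Iio n from hmn)).trans le_sup_left) le_rfl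

lemma measurable_past_message {m n : ℕ} (hmn : m < n) :
    Measurable[past N A S T n] (messageTimes N S T m) :=
  Measurable.mono (comap_measurable _)
    ((le_biSup (fun m => MeasurableSpace.comap (messageTimes N S T m) inferInstance)
      (show m ∈ Set.Iio n from hmn)).trans le_sup_right) le_rfl

lemma measurable_past_queue {m n : ℕ} (hmn : m < n) {j : ℕ} (hj : j ∈ Finset.Icc 1 (N - 2)) :
    Measurable[past N A S T n] (T m j) :=
  ((measurable_pi_apply (⟨j, hj⟩ : Finset.Icc 1 (N - 2))).comp measurable_snd).comp
    (measurable_past_message hmn)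

lemma measurable_present_arrival (n : ℕ) : Measurable[present N A S T n] (A n) :=
  Measurable.mono (comap_measurable _) le_sup_left le_rfl

lemma measurable_present_message (n : ℕ) :
    Measurable[present N A S T n] (messageTimes N S T n) :=
  Measurable.mono (comap_measurable _) le_sup_right le_rfl

lemma measurable_present_queue (n : ℕ) {j : ℕ} (hj : j ∈ Finset.Icc 1 (N - 2)) :
    Measurable[present N A S T n] (T n j) :=
  ((measurable_pi_apply (⟨j, hj⟩ : Finset.Icc 1 (N - 2))).comp measurable_snd).comp
    (measurable_present_message n)

lemma measurable_present_hop (n : ℕ) {j : ℕ} (hj : j ∈ Finset.Icc 1 (N - 1)) :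
    Measurable[present N A S T n] (S n j) :=
  ((measurable_pi_apply (⟨j, hj⟩ : Finset.Icc 1 (N - 1))).comp measurable_fst).comp
    (measurable_present_message n)

end Information

/-! ### Joint law, shift invariance and independence in the model -/

section Model

variable {Ω : Type*} [mΩ : MeasurableSpace Ω] {N : ℕ} {lam : ℝ} {ν : Measure (MessageTimes N)}
  {A : ℕ → Ω → ℝ} {S T : ℕ → ℕ → Ω → ℝ} {Q : Measure Ω}

lemma measurable_messageTimes (hS : ∀ n i, Measurable (S n i)) (hT : ∀ n i, Measurable (T n i))
    (n : ℕ) : Measurable (messageTimes N S T n) :=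
  (measurable_pi_lambda _ fun _ => hS _ _).prodMk (measurable_pi_lambda _ fun _ => hT _ _)

lemma IsQueueingModel.isProbabilityMeasure (h : IsQueueingModel N lam ν A S T Q) :
    IsProbabilityMeasure Q := h.arrival_indep.isProbabilityMeasure

lemma IsQueueingModel.isProbabilityMeasure_messageLaw (h : IsQueueingModel N lam ν A S T Q) :
    IsProbabilityMeasure ν :=
  have := h.isProbabilityMeasure
  (h.message_law 0).isProbabilityMeasure_iff.1 this

/-- The joint law of all arrival and service times. -/
lemma IsQueueingModel.hasLaw (h : IsQueueingModel N lam ν A S T Q) :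
    HasLaw (fun ω => ((fun n => A n ω), fun n => messageTimes N S T n ω))
      ((Measure.infinitePi fun _ : ℕ => expMeasure (1 / lam)).prod
        (Measure.infinitePi fun _ : ℕ => ν)) Q := by
  have := h.isProbabilityMeasure
  have hA : AEMeasurable (fun ω n => A n ω) Q :=
    aemeasurable_pi_iff.2 fun n => (h.arrival_law n).aemeasurable
  have hM : AEMeasurable (fun ω n => messageTimes N S T n ω) Q :=
    aemeasurable_pi_iff.2 fun n => (h.message_law n).aemeasurable
  refine ⟨hA.prodMk hM, ?_⟩
  rw [(indepFun_iff_map_prod_eq_prod_map_map hA hM).1 h.arrival_message_indep,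
    h.arrival_indep.map_fun_eq_infinitePi_map₀ hA, h.message_indep.map_fun_eq_infinitePi_map₀ hM]
  simp only [(h.arrival_law _).map_eq, (h.message_law _).map_eq]

/-- Forgetting message `0` leaves the model invariant. -/
lemma IsQueueingModel.shift (h : IsQueueingModel N lam ν A S T Q) :
    IsQueueingModel N lam ν (fun n => A (n + 1)) (fun n => S (n + 1)) (fun n => T (n + 1)) Q where
  arrival_law n := h.arrival_law (n + 1)
  arrival_indep := h.arrival_indep.precomp (add_left_injective 1)
  message_law n := h.message_law (n + 1)
  message_indep := h.message_indep.precomp (g := (· + 1)) (add_left_injective 1)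
  arrival_message_indep := h.arrival_message_indep.comp
    (φ := fun (a : ℕ → ℝ) n => a (n + 1)) (ψ := fun (x : ℕ → MessageTimes N) n => x (n + 1))
    (by fun_prop) (by fun_prop)

section Measurable

variable (h : IsQueueingModel N lam ν A S T Q) (hA : ∀ n, Measurable (A n))
  (hS : ∀ n i, Measurable (S n i)) (hT : ∀ n i, Measurable (T n i))

include hA hS hT

lemma past_le (n : ℕ) : past N A S T n ≤ mΩ :=
  sup_le (iSup₂_le fun m _ => (hA m).comap_le)
    (iSup₂_le fun m _ => (measurable_messageTimes hS hT m).comap_le)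

lemma present_le (n : ℕ) : present N A S T n ≤ mΩ :=
  sup_le (hA n).comap_le (measurable_messageTimes hS hT n).comap_le

include h

/-- Independence within the arrivals, within the messages, and between the two families is regrouped
by `indep_sup_sup`. Any dependence between hop and queue times of one message stays inside
`present`. -/
lemma indep_present_past (n : ℕ) : Indep (present N A S T n) (past N A S T n) Q := by
  have := h.isProbabilityMeasure
  have hM := measurable_messageTimes (N := N) hS hT
  have hn : n ∉ Set.Iio n := by simp
  refine indep_sup_sup (hA n).comap_le (iSup₂_le fun m _ => (hA m).comap_le) (hM n).comap_le
    (iSup₂_le fun m _ => (hM m).comap_le) (indep_comap_iSup_comap h.arrival_indep hA hn)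
    (indep_comap_iSup_comap h.message_indep hM hn) ?_
  refine indep_of_indep_of_le h.arrival_message_indep
    (sup_le ?_ (iSup₂_le fun m _ => ?_)) (sup_le ?_ (iSup₂_le fun m _ => ?_))
  · exact Measurable.comap_le
      ((measurable_pi_apply n).comp (comap_measurable fun ω n => A n ω))
  · exact Measurable.comap_le
      ((measurable_pi_apply m).comp (comap_measurable fun ω n => A n ω))
  · exact Measurable.comap_le
      ((measurable_pi_apply n).comp (comap_measurable fun ω n => messageTimes N S T n ω))
  · exact Measurable.comap_le
      ((measurable_pi_apply m).comp (comap_measurable fun ω n => messageTimes N S T n ω))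

end Measurable

end Model

/-! ### Exponential moments -/

/-- Tilting the exponential density of rate `r` by `exp (θ x)` gives, up to the factor `r / (r -
θ)`, the density of rate `r - θ`. -/
lemma lintegral_exp_mul_expMeasure {r θ : ℝ} (hr : 0 < r) (hθ : θ < r) :
    ∫⁻ x, ENNReal.ofReal (Real.exp (θ * x)) ∂expMeasure r = ENNReal.ofReal (r / (r - θ)) := by
  have hpdf : Measurable (exponentialPDF r) := (measurable_exponentialPDFReal r).ennreal_ofReal
  have hpos : 0 < r - θ := sub_pos.2 hθ
  change ∫⁻ x, ENNReal.ofReal (Real.exp (θ * x)) ∂(volume.withDensity (exponentialPDF r)) = _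
  rw [lintegral_withDensity_eq_lintegral_mul _ hpdf (by fun_prop)]
  have h (x : ℝ) : (exponentialPDF r * fun x => ENNReal.ofReal (Real.exp (θ * x))) x
      = ENNReal.ofReal (r / (r - θ)) * exponentialPDF (r - θ) x := by
    rw [Pi.mul_apply, exponentialPDF_eq, exponentialPDF_eq]
    split_ifs with hx
    · rw [← ENNReal.ofReal_mul (by positivity), ← ENNReal.ofReal_mul (by positivity), mul_assoc,
        ← Real.exp_add]
      congr 1
      field_simp
      ring_nf
    · simp
  simp_rw [h]
  rw [lintegral_const_mul' _ _ ENNReal.ofReal_ne_top, lintegral_exponentialPDF_eq_one hpos, mul_one]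

lemma expMeasure_Iio_zero (r : ℝ) : expMeasure r (Set.Iio 0) = 0 := by
  change volume.withDensity (exponentialPDF r) _ = _
  rw [withDensity_apply _ measurableSet_Iio, lintegral_exponentialPDF_of_nonpos le_rfl]

lemma expMeasure_Ioi_pos {r : ℝ} (hr : 0 < r) (k : ℝ) : 0 < expMeasure r (Set.Ioi k) := by
  have := isProbabilityMeasure_expMeasure hr
  have h := cdf_expMeasure_eq hr k
  rw [cdf_eq_real] at h
  have hlt : (expMeasure r).real (Set.Iic k) < 1 := by
    rw [h]; split_ifs
    · linarith [Real.exp_pos (-(r * k))]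
    · exact one_pos
  rw [← Set.compl_Iic]
  have h2 := probReal_compl_eq_one_sub (μ := expMeasure r) (measurableSet_Iic (a := k))
  refine pos_of_ne_zero fun h0 => ?_
  rw [measureReal_def, h0] at h2
  simp at h2
  linarith

section HasLaw

variable {Ω : Type*} {mΩ : MeasurableSpace Ω} {Q : Measure Ω}

/-- The exponential moment `E[exp (θ X)]`, possibly infinite. -/
noncomputable def expMoment (Q : Measure Ω) (θ : ℝ) (X : Ω → ℝ) : ENNReal :=
  ∫⁻ ω, ENNReal.ofReal (Real.exp (θ * X ω)) ∂Q

lemma expMoment_of_hasLaw {X : Ω → ℝ} {r θ : ℝ} (hX : HasLaw X (expMeasure r) Q) (hr : 0 < r)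
    (hθ : θ < r) : expMoment Q θ X = ENNReal.ofReal (r / (r - θ)) := by
  rw [expMoment, hX.lintegral_comp (f := fun x => ENNReal.ofReal (Real.exp (θ * x)))
    (by fun_prop), lintegral_exp_mul_expMeasure hr hθ]

lemma nonneg_of_hasLaw {X : Ω → ℝ} {r : ℝ} (hX : HasLaw X (expMeasure r) Q) :
    ∀ᵐ ω ∂Q, 0 ≤ X ω := by
  have h : ∀ᵐ x ∂expMeasure r, 0 ≤ x := by
    rw [ae_iff]; simpa [Set.Iio] using expMeasure_Iio_zero r
  exact (hX.ae_iff (p := fun x => 0 ≤ x) measurableSet_Ici.mem).2 h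

lemma expMoment_neg (θ : ℝ) (X : Ω → ℝ) : expMoment Q θ (fun ω => -X ω) = expMoment Q (-θ) X := by
  simp only [expMoment, mul_neg, neg_mul]

lemma expMoment_add {m₁ m₂ : MeasurableSpace Ω} (h₁ : m₁ ≤ mΩ) (h₂ : m₂ ≤ mΩ)
    (h : Indep m₁ m₂ Q) {X Y : Ω → ℝ} (hX : Measurable[m₁] X) (hY : Measurable[m₂] Y) (θ : ℝ) :
    expMoment Q θ (fun ω => X ω + Y ω) = expMoment Q θ X * expMoment Q θ Y := by
  have hf : Measurable fun x : ℝ => ENNReal.ofReal (Real.exp (θ * x)) := by fun_prop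
  refine Eq.trans ?_ (lintegral_mul_eq_lintegral_mul_lintegral_of_independent_measurableSpace
    h₁ h₂ h (hf.comp hX) (hf.comp hY))
  refine lintegral_congr fun ω => ?_
  rw [mul_add, Real.exp_add, ENNReal.ofReal_mul (Real.exp_nonneg _)]

lemma expMoment_max_le {θ : ℝ} {X Y : Ω → ℝ} (hX : Measurable X) :
    expMoment Q θ (fun ω => max (X ω) (Y ω)) ≤ expMoment Q θ X + expMoment Q θ Y := by
  rw [expMoment, expMoment, expMoment, ← lintegral_add_left (by fun_prop)]
  refine lintegral_mono fun ω => ?_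
  rcases le_total (X ω) (Y ω) with h | h
  · simp [max_eq_right h]
  · simp [max_eq_left h]

/-- Chernoff's bound. -/
lemma measure_lt_le_expMoment {θ : ℝ} (hθ : 0 ≤ θ) {X : Ω → ℝ} (hX : Measurable X) (k : ℝ) :
    Q {ω | k < X ω} ≤ ENNReal.ofReal (Real.exp (-(θ * k))) * expMoment Q θ X := by
  rw [expMoment, ← lintegral_const_mul _ (by fun_prop),
    show {ω | k < X ω} = X ⁻¹' Set.Ioi k from rfl, ← lintegral_indicator_one (hX measurableSet_Ioi)]
  refine lintegral_mono fun ω => ?_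
  by_cases hω : ω ∈ X ⁻¹' Set.Ioi k
  · rw [Set.indicator_of_mem hω, ← ENNReal.ofReal_mul (Real.exp_nonneg _), ← Real.exp_add,
      Pi.one_apply, ← ENNReal.ofReal_one]
    apply ENNReal.ofReal_le_ofReal
    rw [Real.one_le_exp_iff]
    nlinarith [show k < X ω from hω]
  · rw [Set.indicator_of_notMem hω]; exact zero_le

end HasLaw

lemma endToEndDelay_eq (N : ℕ) (A : ℕ → ℝ) (S T : ℕ → ℕ → ℝ) (n : ℕ) :
    endToEndDelay N A S T n
      = ∑ i ∈ Finset.Icc 1 (N - 1), S n i + totalWaiting A T n (N - 2) :=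
  add_comm _ _

/-! ### Information available before a service -/

section Information

variable {Ω : Type*} {N : ℕ} {A : ℕ → Ω → ℝ} {S T : ℕ → ℕ → Ω → ℝ}

/-- What is known of the messages up to message `n` before its service at queue `i`. -/
abbrev beforeService (N : ℕ) (A : ℕ → Ω → ℝ) (S T : ℕ → ℕ → Ω → ℝ) (n i : ℕ) :
    MeasurableSpace Ω :=
  ((⨆ j ∈ {j : Finset.Icc 1 (N - 2) | j.1 < i}, MeasurableSpace.comap (T n j) inferInstance) ⊔
    MeasurableSpace.comap (A n) inferInstance) ⊔ past N A S T n

lemma measurable_beforeService_arrival {l n : ℕ} (hl : l ≤ n) (i : ℕ) :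
    Measurable[beforeService N A S T n i] (A l) := by
  rcases hl.lt_or_eq with hl | rfl
  · exact Measurable.mono (measurable_past_arrival hl) le_sup_right le_rfl
  · exact Measurable.mono (comap_measurable _) (le_sup_right.trans le_sup_left) le_rfl

lemma measurable_beforeService_queue {l n i j : ℕ} (hl : l ≤ n) (hj : j ∈ Finset.Icc 1 (N - 2))
    (h : l < n ∨ j < i) : Measurable[beforeService N A S T n i] (T l j) := by
  rcases hl.lt_or_eq with hl | rfl
  · exact Measurable.mono (measurable_past_queue hl hj) le_sup_right le_rfl
  · refine Measurable.mono (comap_measurable _) ((le_biSup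
      (fun j : Finset.Icc 1 (N - 2) => MeasurableSpace.comap (T l j) inferInstance)
      (show (⟨j, hj⟩ : Finset.Icc 1 (N - 2)) ∈ {j : Finset.Icc 1 (N - 2) | j.1 < i} from
        h.resolve_left (lt_irrefl _))).trans (le_sup_left.trans le_sup_left)) le_rfl

lemma measurable_beforeService_totalSojourn {n i : ℕ} (hi : i + 1 ∈ Finset.Icc 1 (N - 2)) :
    Measurable[beforeService N A S T n (i + 1)]
      fun ω => totalSojourn (fun l => A l ω) (fun l j => T l j ω) n i := by
  rw [Finset.mem_Icc] at hi
  refine measurable_totalSojourn (fun l hl => measurable_beforeService_arrival hl _)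
    fun l hl j hj => ?_
  rw [Finset.mem_Icc] at hj
  exact measurable_beforeService_queue hl (Finset.mem_Icc.2 ⟨hj.1, by omega⟩) (.inr (by omega))

lemma measurable_past_totalSojourn {n i : ℕ} (hi : i ≤ N - 2) :
    Measurable[past N A S T (n + 1)]
      fun ω => totalSojourn (fun l => A l ω) (fun l j => T l j ω) n i :=
  measurable_totalSojourn (fun l hl => measurable_past_arrival (by omega))
    fun l hl j hj => measurable_past_queue (by omega)
      (Finset.Icc_subset_Icc_right hi hj)

end Information

/-! ### Exponential upper bound for the delay -/

section Model

variable {Ω : Type*} [mΩ : MeasurableSpace Ω] {N : ℕ} {lam : ℝ} {m : ℕ → ℝ}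
  {ν : Measure (MessageTimes N)} {A : ℕ → Ω → ℝ} {S T : ℕ → ℕ → Ω → ℝ} {Q : Measure Ω}

lemma IsQueueingModel.hasLaw_queue (h : IsQueueingModel N lam ν A S T Q)
    (hν : IsMessageLaw N m ν) (n : ℕ) {j : ℕ} (hj : j ∈ Finset.Icc 1 (N - 2)) :
    HasLaw (T n j) (expMeasure (1 / (m j + m (j + 1)))) Q :=
  (hν.queue_law ⟨j, hj⟩).comp (h.message_law n)

lemma IsQueueingModel.hasLaw_hop (h : IsQueueingModel N lam ν A S T Q)
    (hν : IsMessageLaw N m ν) (n : ℕ) {j : ℕ} (hj : j ∈ Finset.Icc 1 (N - 1)) :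
    HasLaw (S n j) (expMeasure (1 / m j)) Q :=
  (hν.hop_law ⟨j, hj⟩).comp (h.message_law n)

lemma IsQueueingModel.iIndepFun_queue (h : IsQueueingModel N lam ν A S T Q)
    (hν : IsMessageLaw N m ν) (n : ℕ) :
    iIndepFun (fun (j : Finset.Icc 1 (N - 2)) => T n j) Q := by
  have := h.isProbabilityMeasure
  rw [iIndepFun_iff_hasLaw_pi_pi fun j => h.hasLaw_queue hν n j.2]
  exact (hν.queue_indep.hasLaw_pi hν.queue_law).comp (h.message_law n)

lemma IsQueueingModel.iIndepFun_hop (h : IsQueueingModel N lam ν A S T Q)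
    (hν : IsMessageLaw N m ν) (n : ℕ) :
    iIndepFun (fun (j : Finset.Icc 1 (N - 1)) => S n j) Q := by
  have := h.isProbabilityMeasure
  rw [iIndepFun_iff_hasLaw_pi_pi fun j => h.hasLaw_hop hν n j.2]
  exact (hν.hop_indep.hasLaw_pi hν.hop_law).comp (h.message_law n)

lemma IsQueueingModel.queue_nonneg (h : IsQueueingModel N lam ν A S T Q)
    (hν : IsMessageLaw N m ν) : ∀ᵐ ω ∂Q, ∀ n, ∀ j ∈ Finset.Icc 1 (N - 2), 0 ≤ T n j ω := by
  simp only [ae_all_iff]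
  exact fun n j hj => nonneg_of_hasLaw (h.hasLaw_queue hν n hj)

lemma IsQueueingModel.hop_nonneg (h : IsQueueingModel N lam ν A S T Q)
    (hν : IsMessageLaw N m ν) : ∀ᵐ ω ∂Q, ∀ n, ∀ j ∈ Finset.Icc 1 (N - 1), 0 ≤ S n j ω := by
  simp only [ae_all_iff]
  exact fun n j hj => nonneg_of_hasLaw (h.hasLaw_hop hν n hj)

lemma IsQueueingModel.arrival_nonneg (h : IsQueueingModel N lam ν A S T Q) :
    ∀ᵐ ω ∂Q, ∀ n, 0 ≤ A n ω :=
  ae_all_iff.2 fun n => nonneg_of_hasLaw (h.arrival_law n)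

/-- The exponential moments of the total service time of a message. -/
lemma expMoment_sum_hop (h : IsQueueingModel N lam ν A S T Q)
    (hν : IsMessageLaw N m ν) (hS : ∀ n i, Measurable (S n i)) (n : ℕ) (θ : ℝ) :
    expMoment Q θ (fun ω => ∑ i ∈ Finset.Icc 1 (N - 1), S n i ω)
      = ∏ i ∈ Finset.Icc 1 (N - 1), expMoment Q θ (S n i) := by
  have hf : Measurable fun x : ℝ => ENNReal.ofReal (Real.exp (θ * x)) := by fun_prop
  have hprod := lintegral_prod_eq_prod_lintegral_of_indepFun (μ := Q)
    (Finset.univ : Finset (Finset.Icc 1 (N - 1)))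
    (fun i ω => ENNReal.ofReal (Real.exp (θ * S n i ω)))
    ((h.iIndepFun_hop hν n).comp (fun _ x => ENNReal.ofReal (Real.exp (θ * x))) fun _ => hf)
    (fun i => hf.comp (hS n i))
  rw [← Finset.prod_coe_sort]
  refine Eq.trans (lintegral_congr fun ω => ?_) hprod
  rw [Finset.mul_sum, Real.exp_sum, ENNReal.ofReal_prod_of_nonneg fun _ _ => Real.exp_nonneg _,
    ← Finset.prod_coe_sort]

section Measurable

variable (h : IsQueueingModel N lam ν A S T Q) (hν : IsMessageLaw N m ν)
  (hA : ∀ n, Measurable (A n)) (hS : ∀ n i, Measurable (S n i)) (hT : ∀ n i, Measurable (T n i))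

include hA hS hT

lemma beforeService_le (n i : ℕ) : beforeService N A S T n i ≤ mΩ :=
  sup_le (sup_le (iSup₂_le fun j _ => (hT n j).comap_le) (hA n).comap_le) (past_le hA hS hT n)

include h hν

/-- The service time of message `n` at queue `i` is independent of all that came before. -/
lemma indep_queue_beforeService (n : ℕ) {i : ℕ} (hi : i ∈ Finset.Icc 1 (N - 2)) :
    Indep (MeasurableSpace.comap (T n i) inferInstance) (beforeService N A S T n i) Q := by
  have := h.isProbabilityMeasure
  have hle : ∀ j ∈ Finset.Icc 1 (N - 2), MeasurableSpace.comap (T n j) inferInstance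
      ≤ MeasurableSpace.comap (messageTimes N S T n) inferInstance := fun j hj =>
    Measurable.comap_le (((measurable_pi_apply (⟨j, hj⟩ : Finset.Icc 1 (N - 2))).comp
      measurable_snd).comp (comap_measurable (messageTimes N S T n)))
  have hlow : (⨆ j ∈ {j : Finset.Icc 1 (N - 2) | j.1 < i},
      MeasurableSpace.comap (T n j) inferInstance) ≤ mΩ :=
    iSup₂_le fun j _ => (hT n j).comap_le
  have h1 : Indep (MeasurableSpace.comap (T n i) inferInstance)
      ((⨆ j ∈ {j : Finset.Icc 1 (N - 2) | j.1 < i}, MeasurableSpace.comap (T n j) inferInstance) ⊔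
        MeasurableSpace.comap (A n) inferInstance) Q := by
    refine indep_sup_right (hT n i).comap_le hlow (hA n).comap_le ?_ ?_
    · exact indep_comap_iSup_comap (i := (⟨i, hi⟩ : Finset.Icc 1 (N - 2)))
        (h.iIndepFun_queue hν n) (fun j => hT n j) (by simp)
    · refine (indep_of_indep_of_le h.arrival_message_indep ?_ (sup_le ?_ ?_)).symm
      · exact Measurable.comap_le
          ((measurable_pi_apply n).comp (comap_measurable fun ω n => A n ω))
      · refine (hle i hi).trans (Measurable.comap_le
          ((measurable_pi_apply n).comp (comap_measurable fun ω n => messageTimes N S T n ω)))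
      · refine iSup₂_le fun j _ => (hle j j.2).trans (Measurable.comap_le
          ((measurable_pi_apply n).comp (comap_measurable fun ω n => messageTimes N S T n ω)))
  refine indep_sup_right (hT n i).comap_le (sup_le hlow (hA n).comap_le) (past_le hA hS hT n) h1 ?_
  refine indep_of_indep_of_le_left (indep_present_past h hA hS hT n) ?_
  exact sup_le ((hle i hi).trans le_sup_right)
    (sup_le (iSup₂_le fun j _ => (hle j j.2).trans le_sup_right) le_sup_left)

lemma expMoment_totalSojourn_zero_succ {θ : ℝ} {i : ℕ} (hi : i + 1 ∈ Finset.Icc 1 (N - 2)) :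
    expMoment Q θ (fun ω => totalSojourn (fun l => A l ω) (fun l j => T l j ω) 0 (i + 1))
      = expMoment Q θ (T 0 (i + 1))
        * expMoment Q θ (fun ω => totalSojourn (fun l => A l ω) (fun l j => T l j ω) 0 i) := by
  rw [← expMoment_add (hT 0 (i + 1)).comap_le (beforeService_le hA hS hT 0 (i + 1))
    (indep_queue_beforeService h hν hA hS hT 0 hi) (comap_measurable _)]
  · congr 1
    funext ω
    rw [totalSojourn_zero_left, totalSojourn_zero_left, Finset.sum_Icc_succ_top (by omega),
      add_comm]
  · exact measurable_beforeService_totalSojourn hi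

/-- Exponentiate the last-passage recursion: the service time is independent of `beforeService`, the
maximum costs at most a sum, and the new arrival is independent of the predecessor's sojourn. -/
lemma expMoment_totalSojourn_succ_succ_le {θ : ℝ} {i : ℕ} (n : ℕ)
    (hi : i + 1 ∈ Finset.Icc 1 (N - 2)) :
    expMoment Q θ (fun ω => totalSojourn (fun l => A l ω) (fun l j => T l j ω) (n + 1) (i + 1))
      ≤ expMoment Q θ (T (n + 1) (i + 1))
        * (expMoment Q (-θ) (A (n + 1))
            * expMoment Q θ (fun ω => totalSojourn (fun l => A l ω) (fun l j => T l j ω) n (i + 1))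
          + expMoment Q θ
              (fun ω => totalSojourn (fun l => A l ω) (fun l j => T l j ω) (n + 1) i)) := by
  have hpast : Measurable[past N A S T (n + 1)]
      fun ω => totalSojourn (fun l => A l ω) (fun l j => T l j ω) n (i + 1) :=
    measurable_past_totalSojourn (Finset.mem_Icc.1 hi).2
  have hsub : Measurable[beforeService N A S T (n + 1) (i + 1)] fun ω =>
      totalSojourn (fun l => A l ω) (fun l j => T l j ω) n (i + 1) - A (n + 1) ω :=
    (hpast.mono le_sup_right le_rfl).sub (measurable_beforeService_arrival le_rfl _)
  simp only [totalSojourn_succ_succ]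
  rw [expMoment_add (hT (n + 1) (i + 1)).comap_le (beforeService_le hA hS hT (n + 1) (i + 1))
    (indep_queue_beforeService h hν hA hS hT (n + 1) hi) (comap_measurable _)
    (hsub.max (measurable_beforeService_totalSojourn hi))]
  gcongr
  refine (expMoment_max_le (hsub.mono (beforeService_le hA hS hT _ _) le_rfl)).trans ?_
  gcongr
  have hneg : Measurable[present N A S T (n + 1)] fun ω => -A (n + 1) ω :=
    (measurable_present_arrival _).neg
  rw [← expMoment_neg, ← expMoment_add (present_le hA hS hT (n + 1)) (past_le hA hS hT (n + 1))
    (indep_present_past h hA hS hT (n + 1)) hneg hpast]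
  refine le_of_eq (congrArg _ (funext fun ω => ?_))
  ring

/-- Below the critical exponents of the first `i` queues, the exponential moments of the sojourn
times stay bounded. -/
lemma exists_expMoment_totalSojourn_le (hlam : 0 < lam)
    (hm : ∀ j ∈ Finset.Icc 1 (N - 2), 0 < m j + m (j + 1)) {θ : ℝ} (hθ : 0 < θ) {i : ℕ}
    (hi : i ≤ N - 2) (hθi : ∀ j ∈ Finset.Icc 1 i, θ < 1 / (m j + m (j + 1)) - 1 / lam) :
    ∃ C : ℝ, 0 ≤ C ∧ ∀ n,
      expMoment Q θ (fun ω => totalSojourn (fun l => A l ω) (fun l j => T l j ω) n i)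
        ≤ ENNReal.ofReal C := by
  have := h.isProbabilityMeasure
  induction i with
  | zero => exact ⟨1, zero_le_one, fun n => by simp [expMoment]⟩
  | succ i ih =>
    obtain ⟨C, hC0, hC⟩ := ih (by omega) fun j hj =>
      hθi j (Finset.Icc_subset_Icc_right (Nat.le_succ i) hj)
    have hi' : i + 1 ∈ Finset.Icc 1 (N - 2) := Finset.mem_Icc.2 ⟨by omega, hi⟩
    have hmi := hm (i + 1) hi'
    have hlt := hθi (i + 1) (by simp)
    set M := m (i + 1) + m (i + 1 + 1) with hM
    have hlam' : 0 < 1 / lam := by positivity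
    have hφ (n : ℕ) : expMoment Q θ (T n (i + 1)) = ENNReal.ofReal (1 / M / (1 / M - θ)) :=
      expMoment_of_hasLaw (h.hasLaw_queue hν n hi') (by positivity) (by linarith)
    have hψ (n : ℕ) : expMoment Q (-θ) (A n) = ENNReal.ofReal (1 / lam / (1 / lam - -θ)) :=
      expMoment_of_hasLaw (h.arrival_law n) hlam' (by linarith)
    set φ := 1 / M / (1 / M - θ) with hφdef
    set ψ := 1 / lam / (1 / lam - -θ) with hψdef
    have hφ0 : 0 ≤ φ := div_nonneg (by positivity) (by linarith)
    have hψ0 : 0 ≤ ψ := div_nonneg (by positivity) (by linarith)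
    -- Cleared of denominators, this is `0 < θ * (1 / M - 1 / lam - θ)`.
    have hlt1 : φ * ψ < 1 := by
      rw [hφdef, hψdef, div_mul_div_comm,
        div_lt_one (mul_pos (by linarith) (by linarith))]
      nlinarith
    -- The fixed point of `x ↦ φ * (ψ * x + C)`, so that the bound reproduces itself from one
    -- message to the next.
    set C' := φ * C / (1 - φ * ψ) with hC'
    have hC'0 : 0 ≤ C' := div_nonneg (by positivity) (by linarith)
    have hfix : φ * (ψ * C' + C) = C' := by
      have : C' * (1 - φ * ψ) = φ * C := div_mul_cancel₀ _ (by linarith)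
      linarith
    refine ⟨C', hC'0, fun n => ?_⟩
    induction n with
    | zero =>
      rw [expMoment_totalSojourn_zero_succ h hν hA hS hT hi', hφ]
      calc _ ≤ ENNReal.ofReal φ * ENNReal.ofReal C := by gcongr; exact hC 0
        _ = ENNReal.ofReal (φ * C) := (ENNReal.ofReal_mul hφ0).symm
        _ ≤ _ := ENNReal.ofReal_le_ofReal (by nlinarith [mul_nonneg hφ0 (mul_nonneg hψ0 hC'0)])
    | succ n ihn =>
      refine (expMoment_totalSojourn_succ_succ_le h hν hA hS hT n hi').trans ?_
      rw [hφ, hψ, ← hfix, ENNReal.ofReal_mul hφ0, ENNReal.ofReal_add (by positivity) hC0,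
        ENNReal.ofReal_mul hψ0]
      gcongr
      exact hC (n + 1)

/-- Exponential upper bound for the delay, uniformly in the messages. -/
lemma exists_measure_lt_delay_le (hlam : 0 < lam) (hm : ∀ j ∈ Finset.Icc 1 (N - 1), 0 < m j)
    {θ : ℝ} (hθ : 0 < θ)
    (hθi : ∀ j ∈ Finset.Icc 1 (N - 2), θ < 1 / (m j + m (j + 1)) - 1 / lam)
    (hθm : ∀ j ∈ Finset.Icc 1 (N - 1), θ < 1 / m j) :
    ∃ C : ℝ, 0 ≤ C ∧ ∀ n (k : ℝ),
      Q.real {ω | k < endToEndDelay N (fun l => A l ω) (fun l i => S l i ω) (fun l i => T l i ω)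
        (n + 1)} ≤ C * Real.exp (-(θ * k)) := by
  have := h.isProbabilityMeasure
  have hm2 : ∀ j ∈ Finset.Icc 1 (N - 2), 0 < m j + m (j + 1) := fun j hj => by
    rw [Finset.mem_Icc] at hj
    exact add_pos (hm j (Finset.mem_Icc.2 ⟨hj.1, by omega⟩))
      (hm (j + 1) (Finset.mem_Icc.2 ⟨by omega, by omega⟩))
  obtain ⟨C, hC0, hC⟩ := exists_expMoment_totalSojourn_le h hν hA hS hT hlam hm2 hθ le_rfl hθi
  set B := ∏ i ∈ Finset.Icc 1 (N - 1), (1 / m i / (1 / m i - θ))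
  have hB (n : ℕ) : expMoment Q θ (fun ω => ∑ i ∈ Finset.Icc 1 (N - 1), S n i ω)
      = ENNReal.ofReal B := by
    rw [expMoment_sum_hop h hν hS, ENNReal.ofReal_prod_of_nonneg]
    · refine Finset.prod_congr rfl fun i hi => ?_
      have := hm i hi
      exact expMoment_of_hasLaw (h.hasLaw_hop hν n hi) (by positivity) (hθm i hi)
    · intro i hi
      have := hm i hi
      exact div_nonneg (by positivity) (by linarith [hθm i hi])
  have hB0 : 0 ≤ B := Finset.prod_nonneg fun i hi => by
    have := hm i hi
    exact div_nonneg (by positivity) (by linarith [hθm i hi])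
  refine ⟨B * C, by positivity, fun n k => ?_⟩
  -- The waiting time of message `n + 1` may depend on its hop times through its queue times. Its
  -- bound by the sojourn of message `n` lies in the past, hence is independent of those hop times.
  have hpast : Measurable[past N A S T (n + 1)]
      fun ω => totalSojourn (fun l => A l ω) (fun l j => T l j ω) n (N - 2) :=
    measurable_past_totalSojourn le_rfl
  have hsum : Measurable[present N A S T (n + 1)]
      fun ω => ∑ i ∈ Finset.Icc 1 (N - 1), S (n + 1) i ω :=
    Finset.measurable_sum _ fun i hi => measurable_present_hop _ hi
  have hmom := expMoment_add (present_le hA hS hT (n + 1)) (past_le hA hS hT (n + 1))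
    (indep_present_past h hA hS hT (n + 1)) hsum hpast θ
  have hle := measure_lt_le_expMoment (Q := Q) hθ.le ((hsum.mono (present_le hA hS hT (n + 1))
    le_rfl).add (hpast.mono (past_le hA hS hT (n + 1)) le_rfl)) k
  refine ENNReal.toReal_le_of_le_ofReal (by positivity) (le_trans (measure_mono_ae ?_)
    (hle.trans ?_))
  · filter_upwards [h.queue_nonneg hν, h.arrival_nonneg] with ω hTω hAω (hω : k < _)
    rw [endToEndDelay_eq] at hω
    refine lt_of_lt_of_le hω ?_
    have := totalWaiting_succ_le (A := fun l => A l ω) (T := fun l j => T l j ω) hAω hTω n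
    simp only [Pi.add_apply]
    gcongr
  · rw [mul_comm (B * C), ENNReal.ofReal_mul (Real.exp_nonneg _), ENNReal.ofReal_mul hB0,
      ← hB (n + 1)]
    gcongr
    exact hmom.le.trans (by gcongr; exact hC n)

end Measurable

end Model

/-! ### Lower bound for the delay -/

/-- Split at `a` and `b`; on the two outer ranges shift the exponent by `η` in the favourable
direction. When the outer terms are small, this bounds the probability of `a < Y` from below. -/
lemma expMoment_le_truncated {Ω : Type*} {mΩ : MeasurableSpace Ω} {Q : Measure Ω} {Y : Ω → ℝ}
    (hY : Measurable Y) {θ η : ℝ} (hθ : 0 ≤ θ) (hη : 0 ≤ η) (a b : ℝ) :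
    expMoment Q θ Y ≤ ENNReal.ofReal (Real.exp (η * a)) * expMoment Q (θ - η) Y
      + (ENNReal.ofReal (Real.exp (θ * b)) * Q {ω | a < Y ω}
        + ENNReal.ofReal (Real.exp (-(η * b))) * expMoment Q (θ + η) Y) := by
  have hset : MeasurableSet {ω | a < Y ω} := hY measurableSet_Ioi
  rw [expMoment, expMoment, expMoment, ← lintegral_const_mul _ (by fun_prop),
    ← lintegral_const_mul _ (by fun_prop), ← lintegral_indicator_one hset,
    ← lintegral_const_mul _ (measurable_one.indicator hset),
    ← lintegral_add_left ((measurable_one.indicator hset).const_mul _),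
    ← lintegral_add_left (by fun_prop)]
  refine lintegral_mono fun ω => ?_
  simp only
  rcases le_or_gt (Y ω) a with h | h
  · refine le_trans ?_ le_self_add
    rw [← ENNReal.ofReal_mul (Real.exp_nonneg _), ← Real.exp_add]
    gcongr
    nlinarith
  refine le_trans ?_ le_add_self
  rcases le_or_gt (Y ω) b with h' | h'
  · refine le_trans ?_ le_self_add
    rw [Set.indicator_of_mem (show ω ∈ {ω | a < Y ω} from h), Pi.one_apply, mul_one]
    gcongr
  · refine le_trans ?_ le_add_self
    rw [← ENNReal.ofReal_mul (Real.exp_nonneg _), ← Real.exp_add]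
    gcongr
    nlinarith

/-- The exponential moment at `θ` of the difference of independent exponential variables with means
`M` and `lam`. -/
noncomputable def stepMoment (M lam θ : ℝ) : ℝ :=
  1 / M / (1 / M - θ) * (1 / lam / (1 / lam + θ))

lemma stepMoment_critical_add {M lam η : ℝ} (hM : 0 < M) (hlam : 0 < lam) (h1 : 1 - lam * η ≠ 0)
    (h2 : 1 + M * η ≠ 0) :
    stepMoment M lam (1 / M - 1 / lam + η) = 1 / ((1 - lam * η) * (1 + M * η)) := by
  have e1 : 1 / M - (1 / M - 1 / lam + η) = (1 - lam * η) / lam := by field_simp; ring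
  have e2 : 1 / lam + (1 / M - 1 / lam + η) = (1 + M * η) / M := by field_simp; ring
  rw [stepMoment, e1, e2]
  field_simp

/-- At the critical exponent the step has exponential moment `1`, with derivative `lam - M`. -/
lemma exists_stepMoment_lt_one {M lam α β : ℝ} (hM : 0 < M) (hlam : 0 < lam) (hα : 0 < α)
    (hα' : α < lam - M) (hβ : lam - M < β) :
    ∃ η, 0 < η ∧ η < 1 / lam ∧
      Real.exp (η * α) * stepMoment M lam (1 / M - 1 / lam - η) < 1 ∧
      Real.exp (-(η * β)) * stepMoment M lam (1 / M - 1 / lam + η) < 1 := by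
  -- The two polynomials are `((1 - η α)(1 + lam η)(1 - M η) - 1) / η` and `((1 + η β)(1 - lam η)(1
  -- + M η) - 1) / η`. They suffice because `exp (η α) ≤ 1 / (1 - η α)` and `1 + η β ≤ exp (η β)`.
  have hc1 : ∀ᶠ η : ℝ in 𝓝[>] 0,
      0 < (lam - M) - α - η * (M * lam + α * (lam - M)) + η ^ 2 * (α * M * lam) := by
    refine (Continuous.tendsto' (by fun_prop) 0 ((lam - M) - α) (by ring)).eventually_const_lt
      (sub_pos.2 hα') |>.filter_mono nhdsWithin_le_nhds
  have hc2 : ∀ᶠ η : ℝ in 𝓝[>] 0,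
      0 < β - (lam - M) - η * (M * lam + β * (lam - M)) - η ^ 2 * (β * M * lam) := by
    refine (Continuous.tendsto' (by fun_prop) 0 (β - (lam - M)) (by ring)).eventually_const_lt
      (sub_pos.2 hβ) |>.filter_mono nhdsWithin_le_nhds
  have hsmall (x : ℝ) (hx : 0 < x) : ∀ᶠ η : ℝ in 𝓝[>] 0, η < x :=
    (eventually_lt_nhds hx).filter_mono nhdsWithin_le_nhds
  obtain ⟨η, hη1, hη2, hηl, hηα, hη⟩ := (hc1.and (hc2.and ((hsmall (1 / lam) (by positivity)).and
    ((hsmall (1 / α) (by positivity)).and self_mem_nhdsWithin)))).exists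
  have hη0 : 0 < η := hη
  rw [lt_div_iff₀ hlam] at hηl
  rw [lt_div_iff₀ hα] at hηα
  have hMη : M * η < 1 := by nlinarith
  refine ⟨η, hη0, by rwa [lt_div_iff₀ hlam], ?_, ?_⟩
  · rw [sub_eq_add_neg, stepMoment_critical_add hM hlam (by nlinarith) (by nlinarith), mul_one_div,
      div_lt_one (mul_pos (by nlinarith) (by nlinarith))]
    have h1 : Real.exp (η * α) * (1 - η * α) ≤ 1 := by
      have h2 : 1 - η * α ≤ Real.exp (-(η * α)) := by
        linarith [Real.add_one_le_exp (-(η * α))]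
      calc _ ≤ Real.exp (η * α) * Real.exp (-(η * α)) := by gcongr
        _ = 1 := by rw [← Real.exp_add]; simp
    have h3 : 1 < (1 - η * α) * ((1 - lam * -η) * (1 + M * -η)) := by
      nlinarith [mul_pos hη0 hη1]
    have h4 : 0 < 1 - η * α := by linarith
    have h5 := Real.exp_pos (η * α)
    by_contra! hcon
    have := mul_le_mul_of_nonneg_right hcon h4.le
    linarith
  · rw [stepMoment_critical_add hM hlam (by nlinarith) (by nlinarith), mul_one_div,
      div_lt_one (mul_pos (by nlinarith) (by nlinarith)), Real.exp_neg,
      inv_lt_iff_one_lt_mul₀ (Real.exp_pos _), mul_comm]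
    have h1 : 1 + η * β ≤ Real.exp (η * β) := by linarith [Real.add_one_le_exp (η * β)]
    have h3 : 1 < (1 + η * β) * ((1 - lam * η) * (1 + M * η)) := by
      nlinarith [mul_pos hη0 hη2]
    have h4 : 0 ≤ (1 - lam * η) * (1 + M * η) := mul_nonneg (by nlinarith) (by nlinarith)
    exact h3.trans_le (mul_le_mul_of_nonneg_right h1 h4)

section Model

variable {Ω : Type*} [mΩ : MeasurableSpace Ω] {N : ℕ} {lam : ℝ} {m : ℕ → ℝ}
  {ν : Measure (MessageTimes N)} {A : ℕ → Ω → ℝ} {S T : ℕ → ℕ → Ω → ℝ} {Q : Measure Ω}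

/-- The inter-arrival time and the queue service times of a message are tight. -/
lemma exists_measure_present_le (h : IsQueueingModel N lam ν A S T Q) : ∃ q c : ℝ, 0 < q ∧ ∀ n,
    q ≤ Q.real {ω | A n ω + ∑ i ∈ Finset.Icc 1 (N - 2), T n i ω ≤ c} := by
  have := h.isProbabilityMeasure
  have hmsg := h.isProbabilityMeasure_messageLaw
  have hlaw (n : ℕ) : HasLaw (fun ω => (A n ω, messageTimes N S T n ω))
      ((expMeasure (1 / lam)).prod ν) Q :=
    IndepFun.hasLaw_prod (h.arrival_law n) (h.message_law n)
      (h.arrival_message_indep.comp (measurable_pi_apply n) (measurable_pi_apply n))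
  set f : ℝ × MessageTimes N → ℝ := fun x => x.1 + ∑ i, x.2.2 i
  have hf : Measurable f := by fun_prop
  have hκ := (hlaw 0).isProbabilityMeasure_iff.1 this
  obtain ⟨c, hc⟩ : ∃ c : ℕ, (expMeasure (1 / lam)).prod ν {x | f x ≤ c} ≠ 0 := by
    by_contra! hcon
    have h0 := measure_iUnion_null hcon
    have huniv : (⋃ c : ℕ, {x | f x ≤ c}) = Set.univ :=
      Set.eq_univ_of_forall fun x => Set.mem_iUnion.2 (exists_nat_ge (f x))
    rw [huniv, measure_univ] at h0
    exact one_ne_zero h0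
  refine ⟨((expMeasure (1 / lam)).prod ν).real {x | f x ≤ c}, c,
    ENNReal.toReal_pos hc (measure_ne_top _ _), fun n => le_of_eq ?_⟩
  rw [← (hlaw n).measureReal_eq (p := fun x => f x ≤ c) (hf measurableSet_Iic)]
  simp only [f, messageTimes]
  congr 1
  ext ω
  rw [Set.mem_ofPred_eq, Set.mem_ofPred_eq, Finset.sum_coe_sort _ fun i => T n i ω]

section Measurable

variable (h : IsQueueingModel N lam ν A S T Q) (hν : IsMessageLaw N m ν)
  (hA : ∀ n, Measurable (A n)) (hS : ∀ n i, Measurable (S n i)) (hT : ∀ n i, Measurable (T n i))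

include hA hS hT h hν

lemma expMoment_walk (hlam : 0 < lam) {j : ℕ} (hj : j ∈ Finset.Icc 1 (N - 2))
    (hm : 0 < m j + m (j + 1)) {θ : ℝ} (hθ : -(1 / lam) < θ) (hθ' : θ < 1 / (m j + m (j + 1)))
    (n : ℕ) :
    expMoment Q θ (fun ω => ∑ l ∈ Finset.range n, (T (l + 1) j ω - A (l + 1) ω))
      = ENNReal.ofReal (stepMoment (m j + m (j + 1)) lam θ ^ n) := by
  have := h.isProbabilityMeasure
  have hlam' : 0 < 1 / lam := by positivity
  have hstep0 : 0 ≤ stepMoment (m j + m (j + 1)) lam θ :=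
    mul_nonneg (div_nonneg (by positivity) (by linarith)) (div_nonneg (by positivity) (by linarith))
  have hstep (l : ℕ) : expMoment Q θ (fun ω => T l j ω + -A l ω)
      = ENNReal.ofReal (stepMoment (m j + m (j + 1)) lam θ) := by
    have hneg : Measurable[beforeService N A S T l j] fun ω => -A l ω :=
      (measurable_beforeService_arrival le_rfl _).neg
    rw [expMoment_add (hT l j).comap_le (beforeService_le hA hS hT l j)
      (indep_queue_beforeService h hν hA hS hT l hj) (comap_measurable _) hneg, expMoment_neg,
      expMoment_of_hasLaw (h.hasLaw_queue hν l hj) (by positivity) hθ',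
      expMoment_of_hasLaw (h.arrival_law l) hlam' (by linarith),
      ← ENNReal.ofReal_mul (div_nonneg (by positivity) (by linarith)), stepMoment, sub_neg_eq_add]
  induction n with
  | zero => simp [expMoment]
  | succ n ih =>
    simp only [Finset.sum_range_succ]
    have hpast : Measurable[past N A S T (n + 1)]
        fun ω => ∑ l ∈ Finset.range n, (T (l + 1) j ω - A (l + 1) ω) :=
      Finset.measurable_sum _ fun l hl => by
        rw [Finset.mem_range] at hl
        exact (measurable_past_queue (by omega) hj).sub (measurable_past_arrival (by omega))
    have hpres : Measurable[present N A S T (n + 1)] fun ω => T (n + 1) j ω - A (n + 1) ω :=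
      (measurable_present_queue _ hj).sub (measurable_present_arrival _)
    rw [expMoment_add (past_le hA hS hT (n + 1)) (present_le hA hS hT (n + 1))
      (indep_present_past h hA hS hT (n + 1)).symm hpast hpres, ih, pow_succ,
      ENNReal.ofReal_mul (pow_nonneg hstep0 n), ← hstep (n + 1)]
    rfl

/-- Cramér's lower bound for the random walk at the critical exponent. -/
lemma eventually_le_measure_walk {j : ℕ} (hj : j ∈ Finset.Icc 1 (N - 2))
    (hm : 0 < m j + m (j + 1)) (hstable : m j + m (j + 1) < lam) {α β : ℝ} (hα : 0 < α)
    (hα' : α < lam - (m j + m (j + 1))) (hβ : lam - (m j + m (j + 1)) < β) :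
    ∀ᶠ n : ℕ in atTop, 1 / 2 * Real.exp (-((1 / (m j + m (j + 1)) - 1 / lam) * (β * n)))
      ≤ Q.real {ω | α * n < ∑ l ∈ Finset.range n, (T (l + 1) j ω - A (l + 1) ω)} := by
  have := h.isProbabilityMeasure
  set M := m j + m (j + 1) with hM
  have hlam : 0 < lam := hm.trans hstable
  obtain ⟨η, hη0, hηl, h1, h2⟩ := exists_stepMoment_lt_one hm hlam hα hα' hβ
  set θ := 1 / M - 1 / lam with hθ
  have hlt : 1 / lam < 1 / M := one_div_lt_one_div_of_lt hm hstable
  have hl0 : 0 < 1 / lam := by positivity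
  have hnn (θ' : ℝ) (ha : -(1 / lam) < θ') (hb : θ' < 1 / M) : 0 ≤ stepMoment M lam θ' :=
    mul_nonneg (div_nonneg (by positivity) (by linarith)) (div_nonneg (by positivity) (by linarith))
  set r₁ := Real.exp (η * α) * stepMoment M lam (θ - η)
  set r₂ := Real.exp (-(η * β)) * stepMoment M lam (θ + η)
  have hr₁ : 0 ≤ r₁ := mul_nonneg (Real.exp_nonneg _) (hnn _ (by linarith) (by linarith))
  have hr₂ : 0 ≤ r₂ := mul_nonneg (Real.exp_nonneg _) (hnn _ (by linarith) (by linarith))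
  have hone : stepMoment M lam θ = 1 := by
    have := stepMoment_critical_add (η := 0) hm hlam (by simp) (by simp)
    simpa [hθ] using this
  have hlim : Tendsto (fun n : ℕ => r₁ ^ n + r₂ ^ n) atTop (𝓝 (0 + 0)) :=
    (tendsto_pow_atTop_nhds_zero_of_lt_one hr₁ h1).add
      (tendsto_pow_atTop_nhds_zero_of_lt_one hr₂ h2)
  -- The full moment at `θ` is 1 and the outer ranges contribute at most `r₁ ^ n + r₂ ^ n ≤ 1 / 2`,
  -- so the middle range carries at least `1 / 2`.
  filter_upwards [hlim.eventually_le_const (show (0 : ℝ) + 0 < 1 / 2 by norm_num)] with n hn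
  have hmeas : Measurable fun ω => ∑ l ∈ Finset.range n, (T (l + 1) j ω - A (l + 1) ω) :=
    Finset.measurable_sum _ fun l _ => (hT _ _).sub (hA _)
  have key := expMoment_le_truncated (Q := Q) hmeas (show 0 ≤ θ by linarith) hη0.le (α * n) (β * n)
  rw [expMoment_walk h hν hA hS hT hlam hj hm (by linarith) (by linarith),
    expMoment_walk h hν hA hS hT hlam hj hm (by linarith) (by linarith),
    expMoment_walk h hν hA hS hT hlam hj hm (by linarith) (by linarith),
    ← ofReal_measureReal, ← ENNReal.ofReal_mul (Real.exp_nonneg _),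
    ← ENNReal.ofReal_mul (Real.exp_nonneg _), ← ENNReal.ofReal_mul (Real.exp_nonneg _),
    ← ENNReal.ofReal_add (by positivity)
      (mul_nonneg (Real.exp_nonneg _) (pow_nonneg (hnn _ (by linarith) (by linarith)) _)),
    ← ENNReal.ofReal_add
      (mul_nonneg (Real.exp_nonneg _) (pow_nonneg (hnn _ (by linarith) (by linarith)) _))
      (add_nonneg (by positivity)
        (mul_nonneg (Real.exp_nonneg _) (pow_nonneg (hnn _ (by linarith) (by linarith)) _))),
    ENNReal.ofReal_le_ofReal_iff (add_nonneg
      (mul_nonneg (Real.exp_nonneg _) (pow_nonneg (hnn _ (by linarith) (by linarith)) _))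
      (add_nonneg (by positivity)
        (mul_nonneg (Real.exp_nonneg _) (pow_nonneg (hnn _ (by linarith) (by linarith)) _)))),
    hone, one_pow] at key
  have e₁ : Real.exp (η * (α * n)) * stepMoment M lam (θ - η) ^ n = r₁ ^ n := by
    rw [mul_pow, ← Real.exp_nat_mul]; ring_nf
  have e₂ : Real.exp (-(η * (β * n))) * stepMoment M lam (θ + η) ^ n = r₂ ^ n := by
    rw [mul_pow, ← Real.exp_nat_mul]; ring_nf
  rw [e₁, e₂] at key
  rw [Real.exp_neg, ← div_eq_mul_inv, div_le_iff₀ (Real.exp_pos _)]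
  linarith

/-- Exponential lower bound for the delay. -/
lemma exists_le_measure_lt_delay {j : ℕ} (hj : j ∈ Finset.Icc 1 (N - 2))
    (hm : 0 < m j + m (j + 1)) (hstable : m j + m (j + 1) < lam) {α β : ℝ} (hα : 0 < α)
    (hα' : α < lam - (m j + m (j + 1))) (hβ : lam - (m j + m (j + 1)) < β) :
    ∃ q c : ℝ, 0 < q ∧ ∀ᶠ n : ℕ in atTop, ∀ k, k + c ≤ α * n →
      q * Real.exp (-((1 / (m j + m (j + 1)) - 1 / lam) * (β * n)))
        ≤ Q.real {ω | k < endToEndDelay N (fun l => A l ω) (fun l i => S l i ω)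
            (fun l i => T l i ω) (n + 1)} := by
  have := h.isProbabilityMeasure
  obtain ⟨q, c, hq, hqc⟩ := exists_measure_present_le h
  refine ⟨1 / 2 * q, c, by positivity, ?_⟩
  filter_upwards [eventually_le_measure_walk h hν hA hS hT hj hm hstable hα hα' hβ] with n hn k hk
  have hpast : MeasurableSet[past N A S T (n + 1)]
      {ω | α * n < ∑ l ∈ Finset.range n, (T (l + 1) j ω - A (l + 1) ω)} := by
    refine measurableSet_lt measurable_const (Finset.measurable_sum _ fun l hl => ?_)
    rw [Finset.mem_range] at hl
    exact (measurable_past_queue (by omega) hj).sub (measurable_past_arrival (by omega))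
  have hpres : MeasurableSet[present N A S T (n + 1)]
      {ω | A (n + 1) ω + ∑ i ∈ Finset.Icc 1 (N - 2), T (n + 1) i ω ≤ c} :=
    measurableSet_le ((measurable_present_arrival _).add
      (Finset.measurable_sum _ fun i hi => measurable_present_queue _ hi)) measurable_const
  have hind := (Indep_iff _ _ _).1 (indep_present_past h hA hS hT (n + 1)) _ _ hpres hpast
  set E₁ := {ω | A (n + 1) ω + ∑ i ∈ Finset.Icc 1 (N - 2), T (n + 1) i ω ≤ c} with hE₁
  set E₂ := {ω | α * n < ∑ l ∈ Finset.range n, (T (l + 1) j ω - A (l + 1) ω)} with hE₂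
  calc _ = q * (1 / 2 * Real.exp (-((1 / (m j + m (j + 1)) - 1 / lam) * (β * n)))) := by ring
    _ ≤ Q.real E₁ * Q.real E₂ := mul_le_mul (hqc (n + 1)) hn (by positivity) measureReal_nonneg
    _ = Q.real (E₁ ∩ E₂) := by
        rw [measureReal_def, measureReal_def, ← ENNReal.toReal_mul, ← hind, measureReal_def]
    _ ≤ _ := ENNReal.toReal_mono (measure_ne_top _ _) (measure_mono_ae ?_)
  filter_upwards [h.queue_nonneg hν, h.hop_nonneg hν] with ω hTω hSω hω
  have hω1 : A (n + 1) ω + ∑ i ∈ Finset.Icc 1 (N - 2), T (n + 1) i ω ≤ c := hω.1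
  have hω2 : α * n < ∑ l ∈ Finset.range n, (T (l + 1) j ω - A (l + 1) ω) := hω.2
  change k < _
  rw [endToEndDelay_eq]
  have h1 := le_totalWaiting_succ (A := fun l => A l ω) (T := fun l i => T l i ω) hTω n hj
  have h2 := sum_range_le_totalSojourn (A := fun l => A l ω) (T := fun l i => T l i ω) (j := j)
    (fun n l hl => hTω n l (Finset.Icc_subset_Icc_right (Finset.mem_Icc.1 hj).2 hl))
    (Finset.mem_Icc.1 hj).1 n
  have h3 := Finset.sum_nonneg (hSω (n + 1))
  linarith

end Measurable

end Model

/-! ### The stationary limit and its decay rate -/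

lemma tendsto_log_div_of_exp_bounds {p : ℝ → ℝ} {θ : ℝ} (hθ : 0 < θ) (hp : ∀ k, 0 < p k)
    (hupper : ∀ γ, 0 < γ → γ < θ → ∃ C, ∀ k, p k ≤ C * Real.exp (-(γ * k)))
    (hlower : ∀ γ, θ < γ → ∃ c, 0 < c ∧ ∀ᶠ k in atTop, c * Real.exp (-(γ * k)) ≤ p k) :
    Tendsto (fun k : ℝ => 1 / k * Real.log (p k)) atTop (𝓝 (-θ)) := by
  have hlim (c γ : ℝ) : Tendsto (fun k : ℝ => Real.log c / k - γ) atTop (𝓝 (-γ)) := by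
    simpa using (tendsto_const_nhds.div_atTop tendsto_id).sub_const γ
  have hlog {c γ k : ℝ} (hc : 0 < c) (hk : 0 < k) :
      1 / k * Real.log (c * Real.exp (-(γ * k))) = Real.log c / k - γ := by
    rw [Real.log_mul hc.ne' (Real.exp_pos _).ne', Real.log_exp]
    field_simp
    ring
  rw [tendsto_order]
  constructor
  · intro a ha
    obtain ⟨γ, hγ, hγa⟩ := exists_between (show θ < -a by linarith)
    obtain ⟨c, hc, hcp⟩ := hlower γ hγ
    filter_upwards [hcp, (hlim c γ).eventually_const_lt (show a < -γ by linarith),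
      eventually_gt_atTop 0] with k hk1 hk2 hk3
    refine hk2.trans_le ?_
    rw [← hlog hc hk3]
    gcongr
  · intro a ha
    -- The maximum with 0 keeps `γ` positive, as the upper bound requires.
    obtain ⟨γ, hγa, hγ⟩ := exists_between (show max (-a) 0 < θ from max_lt (by linarith) hθ)
    rw [max_lt_iff] at hγa
    obtain ⟨C, hC⟩ := hupper γ hγa.2 hγ
    have hC0 : 0 < C := pos_of_mul_pos_left ((hp 0).trans_le (hC 0)) (Real.exp_nonneg _)
    filter_upwards [(hlim C γ).eventually_lt_const (show -γ < a by linarith),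
      eventually_gt_atTop 0] with k hk2 hk3
    refine lt_of_le_of_lt ?_ hk2
    rw [← hlog hC0 hk3]
    have := hp k
    gcongr
    exact hC k

/-- The service times on the hops, read off from the times attached to the messages. -/
noncomputable def hopTimes {N : ℕ} (x : ℕ → MessageTimes N) (n i : ℕ) : ℝ :=
  if hi : i ∈ Finset.Icc 1 (N - 1) then (x n).1 ⟨i, hi⟩ else 0

/-- The service times at the queues, read off from the times attached to the messages. -/
noncomputable def queueTimes {N : ℕ} (x : ℕ → MessageTimes N) (n i : ℕ) : ℝ :=
  if hi : i ∈ Finset.Icc 1 (N - 2) then (x n).2 ⟨i, hi⟩ else 0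

lemma measurable_hopTimes {N : ℕ} (n i : ℕ) :
    Measurable fun x : ℕ → MessageTimes N => hopTimes x n i := by
  unfold hopTimes; split_ifs <;> fun_prop

lemma measurable_queueTimes {N : ℕ} (n i : ℕ) :
    Measurable fun x : ℕ → MessageTimes N => queueTimes x n i := by
  unfold queueTimes; split_ifs <;> fun_prop

/-- The delay uses only hops and queues in range, so the default value 0 elsewhere is invisible. -/
lemma endToEndDelay_messageTimes {Ω : Type*} (N : ℕ) (A : ℕ → ℝ) (S T : ℕ → ℕ → Ω → ℝ) (n : ℕ)
    (ω : Ω) :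
    endToEndDelay N A (hopTimes fun n => messageTimes N S T n ω)
        (queueTimes fun n => messageTimes N S T n ω) n
      = endToEndDelay N A (fun l i => S l i ω) (fun l i => T l i ω) n := by
  rw [endToEndDelay_eq, endToEndDelay_eq]
  congr 1
  · exact Finset.sum_congr rfl fun i hi => dif_pos hi
  · refine totalWaiting_congr (fun l i hi => ?_) n
    exact dif_pos hi

/-! ### Transfer to the canonical sequence space -/

section Model

variable {N : ℕ} {lam : ℝ} {m : ℕ → ℝ} {ν : Measure (MessageTimes N)}

lemma measurable_endToEndDelay (N n : ℕ) :
    Measurable fun x : (ℕ → ℝ) × (ℕ → MessageTimes N) =>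
      endToEndDelay N x.1 (hopTimes x.2) (queueTimes x.2) n := by
  simp only [endToEndDelay_eq]
  refine (Finset.measurable_sum _ fun i _ => (measurable_hopTimes n i).comp measurable_snd).add ?_
  exact measurable_totalWaiting (A := fun l (x : (ℕ → ℝ) × (ℕ → MessageTimes N)) => x.1 l)
    (T := fun l i (x : (ℕ → ℝ) × (ℕ → MessageTimes N)) => queueTimes x.2 l i)
    (fun l _ => by fun_prop) fun l _ i _ => (measurable_queueTimes l i).comp measurable_snd

/-- The canonical probability of missing the deadline `k`. -/
noncomputable def canonicalMissProb (N : ℕ) (lam : ℝ) (ν : Measure (MessageTimes N)) (n : ℕ)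
    (k : ℝ) : ℝ :=
  ((Measure.infinitePi fun _ : ℕ => expMeasure (1 / lam)).prod
    (Measure.infinitePi fun _ : ℕ => ν)).real
      {x | k < endToEndDelay N x.1 (hopTimes x.2) (queueTimes x.2) n}

/-- The right side no longer involves `Q`; this makes conditional measures for different messages
comparable. -/
lemma IsQueueingModel.measure_lt_delay {Ω : Type*} [MeasurableSpace Ω] {A : ℕ → Ω → ℝ}
    {S T : ℕ → ℕ → Ω → ℝ} {Q : Measure Ω} (h : IsQueueingModel N lam ν A S T Q) (n : ℕ) (k : ℝ) :
    Q.real {ω | k < endToEndDelay N (fun l => A l ω) (fun l i => S l i ω) (fun l i => T l i ω) n}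
      = canonicalMissProb N lam ν n k := by
  rw [canonicalMissProb, ← h.hasLaw.measureReal_eq (p := fun x => k < endToEndDelay N x.1
    (hopTimes x.2) (queueTimes x.2) n) (measurable_endToEndDelay N n measurableSet_Ioi)]
  simp only [endToEndDelay_messageTimes]

/-- The missing probability increases with the index of the message. -/
lemma IsQueueingModel.monotone_canonicalMissProb {Ω : Type*} [MeasurableSpace Ω] {A : ℕ → Ω → ℝ}
    {S T : ℕ → ℕ → Ω → ℝ} {Q : Measure Ω} (h : IsQueueingModel N lam ν A S T Q) (k : ℝ) :
    Monotone fun n => canonicalMissProb N lam ν n k := by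
  have := h.isProbabilityMeasure
  refine monotone_nat_of_le_succ fun n => ?_
  rw [← h.shift.measure_lt_delay n, ← h.measure_lt_delay (n + 1)]
  refine measureReal_mono fun ω (hω : k < _) => ?_
  refine hω.trans_le ?_
  rw [endToEndDelay_eq, endToEndDelay_eq]
  gcongr
  exact totalWaiting_shift_le (fun l => A l ω) (fun l i => T l i ω) n (N - 2)

/-- The model with measurable coordinates, on the space of all sequences. -/
lemma IsQueueingModel.canonical {Ω : Type*} [MeasurableSpace Ω] {A : ℕ → Ω → ℝ}
    {S T : ℕ → ℕ → Ω → ℝ} {Q : Measure Ω} (h : IsQueueingModel N lam ν A S T Q) :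
    IsQueueingModel N lam ν (fun n (x : (ℕ → ℝ) × (ℕ → MessageTimes N)) => x.1 n)
      (fun n i x => hopTimes x.2 n i) (fun n i x => queueTimes x.2 n i)
      ((Measure.infinitePi fun _ : ℕ => expMeasure (1 / lam)).prod
        (Measure.infinitePi fun _ : ℕ => ν)) := by
  have := h.isProbabilityMeasure
  have := h.isProbabilityMeasure_messageLaw
  have := (h.arrival_law 0).isProbabilityMeasure_iff.1 h.isProbabilityMeasure
  have hmsg (n : ℕ) : messageTimes N (fun n i (x : (ℕ → ℝ) × (ℕ → MessageTimes N)) =>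
      hopTimes x.2 n i) (fun n i x => queueTimes x.2 n i) n = fun x => x.2 n := by
    funext x
    refine Prod.ext (funext fun i => ?_) (funext fun i => ?_)
    · exact dif_pos i.2
    · exact dif_pos i.2
  have hA := (measurePreserving_fst (μ := Measure.infinitePi fun _ : ℕ => expMeasure (1 / lam))
    (ν := Measure.infinitePi fun _ : ℕ => ν)).hasLaw
  have hM := (measurePreserving_snd (μ := Measure.infinitePi fun _ : ℕ => expMeasure (1 / lam))
    (ν := Measure.infinitePi fun _ : ℕ => ν)).hasLaw
  have hAn (n : ℕ) := (measurePreserving_eval_infinitePi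
    (fun _ : ℕ => expMeasure (1 / lam)) n).hasLaw.comp hA
  have hMn (n : ℕ) := (measurePreserving_eval_infinitePi (fun _ : ℕ => ν) n).hasLaw.comp hM
  have hmsg' : messageTimes N (fun n i (x : (ℕ → ℝ) × (ℕ → MessageTimes N)) =>
      hopTimes x.2 n i) (fun n i x => queueTimes x.2 n i) = fun n x => x.2 n := funext hmsg
  refine ⟨hAn, ?_, ?_, ?_, ?_⟩
  · rw [iIndepFun_iff_map_fun_eq_infinitePi_map (by fun_prop)]
    exact hA.map_eq.trans (congrArg _ (funext fun n => (hAn n).map_eq.symm))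
  · intro n; rw [hmsg]; exact hMn n
  · rw [hmsg', iIndepFun_iff_map_fun_eq_infinitePi_map (by fun_prop)]
    exact hM.map_eq.trans (congrArg _ (funext fun n => (hMn n).map_eq.symm))
  · rw [hmsg']
    exact indepFun_prod measurable_id measurable_id

/-- The service time on hop 1 alone exceeds any `k` with positive probability. -/
lemma IsQueueingModel.canonicalMissProb_pos {Ω : Type*} [MeasurableSpace Ω] {A : ℕ → Ω → ℝ}
    {S T : ℕ → ℕ → Ω → ℝ} {Q : Measure Ω} (h : IsQueueingModel N lam ν A S T Q)
    (hν : IsMessageLaw N m ν) (hN : 2 ≤ N) (hm : 0 < m 1) (n : ℕ) (k : ℝ) :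
    0 < canonicalMissProb N lam ν n k := by
  have := h.isProbabilityMeasure
  have h1 : 1 ∈ Finset.Icc 1 (N - 1) := Finset.mem_Icc.2 ⟨le_rfl, by omega⟩
  have hpos := expMeasure_Ioi_pos (one_div_pos.2 hm) k
  rw [show Set.Ioi k = {x | k < x} from rfl,
    ← (h.hasLaw_hop hν n h1).measure_eq (p := fun x => k < x) measurableSet_Ioi] at hpos
  rw [← h.measure_lt_delay]
  refine (ENNReal.toReal_pos hpos.ne' (measure_ne_top _ _)).trans_le
    (ENNReal.toReal_mono (measure_ne_top _ _) (measure_mono_ae ?_))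
  filter_upwards [h.hop_nonneg hν] with ω hSω (hω : k < S n 1 ω)
  change k < _
  rw [endToEndDelay_eq]
  have h2 := Finset.single_le_sum (f := fun i => S n i ω) (hSω n) h1
  have h3 := totalWaiting_nonneg (fun l => A l ω) (fun l i => T l i ω) n (N - 2)
  linarith

/-- Bottleneck lower bound for the limiting missing probability. -/
lemma IsQueueingModel.exists_le_limit {Ω : Type*} [MeasurableSpace Ω] {A : ℕ → Ω → ℝ}
    {S T : ℕ → ℕ → Ω → ℝ} {Q : Measure Ω} (h : IsQueueingModel N lam ν A S T Q)
    (hν : IsMessageLaw N m ν) (hA : ∀ n, Measurable (A n)) (hS : ∀ n i, Measurable (S n i))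
    (hT : ∀ n i, Measurable (T n i)) {j : ℕ} (hj : j ∈ Finset.Icc 1 (N - 2))
    (hm : 0 < m j + m (j + 1)) (hstable : m j + m (j + 1) < lam) {p : ℝ → ℝ}
    (hp : ∀ n k, canonicalMissProb N lam ν n k ≤ p k) {γ : ℝ}
    (hγ : 1 / (m j + m (j + 1)) - 1 / lam < γ) :
    ∃ c, 0 < c ∧ ∀ᶠ k in atTop, c * Real.exp (-(γ * k)) ≤ p k := by
  set M := m j + m (j + 1)
  set θ := 1 / M - 1 / lam with hθdef
  have hθ : 0 < θ := sub_pos.2 (one_div_lt_one_div_of_lt hm hstable)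
  -- The slopes `α`, `β` below will have ratio `β / α = t ^ 2`, so the exponent paid per unit of `k`
  -- is `θ * t ^ 2`.
  obtain ⟨t, ht1, ht⟩ : ∃ t : ℝ, 1 < t ∧ θ * t ^ 2 < γ := by
    have : ∀ᶠ t : ℝ in 𝓝[>] 1, θ * t ^ 2 < γ :=
      ((Continuous.tendsto' (by fun_prop) 1 θ (by ring)).eventually_lt_const hγ).filter_mono
        nhdsWithin_le_nhds
    obtain ⟨t, ht, ht1⟩ := (this.and self_mem_nhdsWithin).exists
    exact ⟨t, ht1, ht⟩
  have ht0 : 0 < t := by linarith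
  have hd : 0 < lam - M := sub_pos.2 hstable
  set α := (lam - M) / t with hα
  have hα0 : 0 < α := by positivity
  set β := t * (lam - M) with hβ
  have hβα : β = t ^ 2 * α := by rw [hβ, hα]; field_simp
  obtain ⟨q, c, hq, hev⟩ := exists_le_measure_lt_delay h hν hA hS hT hj hm hstable hα0
    (div_lt_self hd ht1) (show lam - M < β by nlinarith)
  -- The constant absorbs the offset `c` and the rounding of `(k + c) / α` up to an integer.
  refine ⟨q * Real.exp (-(θ * t ^ 2 * (c + α))), by positivity, ?_⟩
  have hceil : Tendsto (fun k : ℝ => ⌈(k + c) / α⌉₊) atTop atTop :=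
    tendsto_nat_ceil_atTop.comp ((tendsto_atTop_add_const_right _ c tendsto_id).atTop_div_const hα0)
  filter_upwards [hceil.eventually hev, eventually_ge_atTop (max 0 (-c))] with k hk hk0
  rw [max_le_iff] at hk0
  set n := ⌈(k + c) / α⌉₊
  have hn1 : k + c ≤ α * n := by
    have := Nat.le_ceil ((k + c) / α)
    rwa [div_le_iff₀' hα0] at this
  have hn2 : α * n ≤ k + c + α := by
    have := (Nat.ceil_lt_add_one (div_nonneg (show 0 ≤ k + c by linarith) hα0.le)).le
    calc α * n ≤ α * ((k + c) / α + 1) := by gcongr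
      _ = _ := by field_simp
  refine le_trans ?_ (((hk k hn1).trans_eq (h.measure_lt_delay _ _)).trans (hp _ _))
  rw [mul_assoc, ← Real.exp_add]
  gcongr
  have h1 : θ * (β * n) ≤ θ * t ^ 2 * (k + c + α) := by
    rw [hβα]
    calc θ * (t ^ 2 * α * n) = θ * t ^ 2 * (α * n) := by ring
      _ ≤ _ := by gcongr
  nlinarith [mul_le_mul_of_nonneg_right ht.le hk0.1]

end Model

end HalfDuplex

/-! ### Assembly of limit, positivity and decay rate -/

theorem theorem11 {Ω : Type*} [MeasurableSpace Ω] (P : Measure Ω) [IsProbabilityMeasure P]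
    (N : ℕ) (hN : 3 ≤ N) (lam : ℝ) (L : ℕ → ℕ) (μ : ℕ → ℕ → ℝ)
    (hμ : ∀ i ∈ Finset.Icc 1 (N - 1), 0 < μ i (L i))
    (hstable : ∀ i ∈ Finset.Icc 1 (N - 2), μ i (L i) + μ (i + 1) (L (i + 1)) < lam)
    (ν : Measure (HalfDuplex.MessageTimes N))
    (hν : HalfDuplex.IsMessageLaw N (fun i => μ i (L i)) ν)
    (t : ℕ → ℕ → Ω → ℝ) (ht : ∀ n i, Measurable (t n i))
    (A : ℕ → Ω → ℝ) (S T : ℕ → ℕ → Ω → ℝ)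
    (hpos : ∀ n, P (HalfDuplex.noOutage N t L n) ≠ 0)
    (hmodel : ∀ n, HalfDuplex.IsQueueingModel N lam ν A S T
      (ProbabilityTheory.cond P (HalfDuplex.noOutage N t L n))) :
    ∃ p : ℝ → ℝ,
      (∀ k : ℝ, 0 < p k ∧
        Tendsto (fun n : ℕ => HalfDuplex.missProb N P t L A S T n k) atTop (𝓝 (p k)) ∧
        Tendsto (fun n : ℕ => 1 / k * Real.log (HalfDuplex.missProb N P t L A S T n k)) atTop
          (𝓝 (1 / k * Real.log (p k)))) ∧
      Tendsto (fun k : ℝ => 1 / k * Real.log (p k)) atTop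
        (𝓝 (-(Finset.Icc 1 (N - 2)).inf' (Finset.nonempty_Icc.mpr (by omega))
          (fun i => 1 / (μ i (L i) + μ (i + 1) (L (i + 1))) - 1 / lam))) := by
  set m : ℕ → ℝ := fun i => μ i (L i) with hm
  have hmiss (n : ℕ) (k : ℝ) : HalfDuplex.missProb N P t L A S T n k
      = HalfDuplex.canonicalMissProb N lam ν n k := (hmodel n).measure_lt_delay n k
  have hmono (k : ℝ) := (hmodel 0).monotone_canonicalMissProb k
  -- The given variables are only almost everywhere measurable; the σ-algebra arguments need the
  -- measurable coordinates of the canonical model.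
  have hQ := (hmodel 0).canonical
  have hQp := hQ.isProbabilityMeasure
  have hbdd (k : ℝ) : BddAbove (Set.range fun n => HalfDuplex.canonicalMissProb N lam ν n k) :=
    ⟨1, by rintro _ ⟨n, rfl⟩; exact measureReal_le_one⟩
  set p : ℝ → ℝ := fun k => ⨆ n, HalfDuplex.canonicalMissProb N lam ν n k
  have hlim (k : ℝ) : Tendsto (fun n => HalfDuplex.canonicalMissProb N lam ν n k) atTop (𝓝 (p k)) :=
    tendsto_atTop_ciSup (hmono k) (hbdd k)
  have hle (n : ℕ) (k : ℝ) : HalfDuplex.canonicalMissProb N lam ν n k ≤ p k :=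
    le_ciSup (hbdd k) n
  have hppos (k : ℝ) : 0 < p k := (hQ.canonicalMissProb_pos hν (by omega)
    (hμ 1 (Finset.mem_Icc.2 ⟨le_rfl, by omega⟩)) 0 k).trans_le (hle 0 k)
  have hmem {i : ℕ} (hi : i ∈ Finset.Icc 1 (N - 2)) :
      i ∈ Finset.Icc 1 (N - 1) ∧ i + 1 ∈ Finset.Icc 1 (N - 1) := by
    simp only [Finset.mem_Icc] at hi ⊢; omega
  have hM (i : ℕ) (hi : i ∈ Finset.Icc 1 (N - 2)) : 0 < m i + m (i + 1) :=
    add_pos (hμ _ (hmem hi).1) (hμ _ (hmem hi).2)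
  have h1 : 1 ∈ Finset.Icc 1 (N - 2) := Finset.mem_Icc.2 ⟨le_rfl, by omega⟩
  have hlam : 0 < lam := (hM 1 h1).trans (hstable 1 h1)
  have hne : (Finset.Icc 1 (N - 2)).Nonempty := ⟨1, h1⟩
  refine ⟨p, fun k => ⟨hppos k, ?_, ?_⟩, ?_⟩
  · simpa only [hmiss] using hlim k
  · simpa only [hmiss] using ((hlim k).log (hppos k).ne').const_mul (1 / k)
  refine HalfDuplex.tendsto_log_div_of_exp_bounds ?_ hppos (fun γ hγ0 hγ => ?_) fun γ hγ => ?_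
  · rw [Finset.lt_inf'_iff]
    exact fun i hi => sub_pos.2 (one_div_lt_one_div_of_lt (hM i hi) (hstable i hi))
  · rw [Finset.lt_inf'_iff] at hγ
    -- Queue `j` contains hop `j`, except that the last hop is the second one of queue `N - 2`.
    have hγm (j : ℕ) (hj : j ∈ Finset.Icc 1 (N - 1)) : γ < 1 / m j := by
      have hl : 0 < 1 / lam := by positivity
      obtain ⟨i, hi, hij⟩ : ∃ i ∈ Finset.Icc 1 (N - 2), m j ≤ m i + m (i + 1) := by
        rw [Finset.mem_Icc] at hj
        rcases Nat.lt_or_ge j (N - 1) with hlt | hge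
        · have hj' : j ∈ Finset.Icc 1 (N - 2) := Finset.mem_Icc.2 ⟨hj.1, by omega⟩
          exact ⟨j, hj', le_add_of_nonneg_right (hμ _ (hmem hj').2).le⟩
        · have hj' : N - 2 ∈ Finset.Icc 1 (N - 2) := Finset.mem_Icc.2 ⟨by omega, le_rfl⟩
          refine ⟨N - 2, hj', ?_⟩
          rw [show j = N - 2 + 1 by omega]
          exact le_add_of_nonneg_left (hμ _ (hmem hj').1).le
      have := one_div_le_one_div_of_le (hμ j hj) hij
      linarith [hγ i hi]
    obtain ⟨C, -, hC⟩ := HalfDuplex.exists_measure_lt_delay_le hQ hν (fun n => by fun_prop)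
      (fun n i => (HalfDuplex.measurable_hopTimes n i).comp measurable_snd)
      (fun n i => (HalfDuplex.measurable_queueTimes n i).comp measurable_snd)
      hlam hμ hγ0 hγ hγm
    refine ⟨C, fun k => ciSup_le fun n => ?_⟩
    -- The moment bound concerns messages with a predecessor; monotonicity moves it from `n + 1` to
    -- `n`.
    exact (hmono k (Nat.le_succ n)).trans (hC n k)
  · obtain ⟨j, hj, hjeq⟩ := Finset.exists_mem_eq_inf' hne
      fun i => 1 / (m i + m (i + 1)) - 1 / lam
    rw [hjeq] at hγ
    exact hQ.exists_le_limit hν (fun n => by fun_prop)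
      (fun n i => (HalfDuplex.measurable_hopTimes n i).comp measurable_snd)
      (fun n i => (HalfDuplex.measurable_queueTimes n i).comp measurable_snd)
      hj (hM j hj) (hstable j hj) hle hγ
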